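/- Let $n\in\{2,3\}$ and let $\Omega\subset\mathbb R^n$ be a bounded domain with Lipschitz continuous boundary $S$, surface measure $ds$ and unit outward normal $\nu$ (both computed in local Lipschitz graph coordinates; Sobolev functions on $\Omega$ have boundary values in the sense of traces). Let $S_1,S_2$ be disjoint relatively open subsets of $S$ with $S_1\neq\emptyset$, $S=\overline{S_1}\cup\overline{S_2}$ and $S\setminus(S_1\cup S_2)$ of surface measure zero. Put $$X=\{u\in H^1(\Omega)^n: u|_{S_1}=0\},\qquad V=\{u\in X:\operatorname{div}u=0\},$$ $\varepsilon_{ij}(u)=\frac12\left(\frac{\partial u_i}{\partial x_j}+\frac{\partial u_j}{\partial x_i}\right)$, $I(u)=\sum_{i,j}\varepsilon_{ij}(u)^2$; repeated indices are summed. Let $E:\Omega\to\mathbb R^n$ be measurable (the electric field), $\check u\in\mathbb R^n$, $\alpha\ge 0$, and let $$\mu(u,E)(x)=\left(\frac{\alpha\mathbf 1+u(x)+\check u}{\alpha\sqrt n+|u(x)+\check u|},\frac{E(x)}{|E(x)|}\right)_{\mathbb R^n}^2,\qquad \mathbf 1=(1,\dots,1),$$ with $\mu(u,E)(x)=0$ where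 $E(x)=0$; the value $\alpha=0$ is permitted only if $u+\check u\neq0$ a.e. in $\Omega$ for the solution $u$ below. Let $b:\mathbb R_+\times[0,1]\to\mathbb R$ be continuous with $0\le b\le a_5$ for some $a_5>0$, and let $\psi:\mathbb R_+^2\times[0,1]\to\mathbb R$ be continuous with $a_1\le\psi\le a_2$ for some $a_1,a_2>0$ and satisfy one of the following: 1. for all $y_2,y_3$ the function $y_1\mapsto\psi(y_1,y_2,y_3)$ is continuously differentiable on $\mathbb R_+=[0,\infty)$, and $\psi+2\frac{\partial\psi}{\partial y_1}y_1\ge a_3$, $\left|\frac{\partial\psi}{\partial y_1}\right|y_1\le a_4$ everywhere, with constants $a_3,a_4>0$; 2. $[\psi(z_1^2,y_2,y_3)z_1-\psi(z_2^2,y_2,y_3)z_2](z_1-z_2)\ge a_3(z_1-z_2)^2$ for all $z_1,z_2\in\mathbb R_+$ and all $y_2,y_3$, with a constant $a_3>0$; 3. for all $y_2,y_3$ the function $z\mapsto\psi(z^2,y_2,y_3)z$ is strictly increasing on $\mathbb R_+$. Consider the singular viscosity $$\phi(I(u),|E|,\mu(u,E))=\frac{b(|E|,\mu(u,E))}{I(u)^{1/2}}+\psi(I(u),|E|,\mu(u,E)),$$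 which is infinite where $I(u)=0$ and $b(|E|,\mu(u,E))>0$, and is understood as $\psi$ where $I(u)=0$ and $b(|E|,\mu(u,E))=0$. Let $K\in L_2(\Omega)^n$, $F\in L_2(S_2)^n$, let $\hat u$ be a given velocity on $S_1$, and let $\tilde u\in H^1(\Omega)^n$ satisfy $\tilde u|_{S_1}=\hat u$ and $\operatorname{div}\tilde u=0$. A pair $(u,p)$ is called a regular solution if $u\in H^1(\Omega)^n$, the viscosity $\phi$ is finite a.e. in $\Omega$, $p\in H^1(\Omega)$ and $\phi\,\varepsilon_{ij}(u)\in H^1(\Omega)$ for all $i,j$, and, for $i=1,\dots,n$, $$\frac{\partial p}{\partial x_i}-2\frac{\partial}{\partial x_j}\big[\phi(I(u),|E|,\mu(u,E))\,\varepsilon_{ij}(u)\big]=K_i,\qquad \operatorname{div}u=0\qquad\text{a.e. in }\Omega,$$ $$u|_{S_1}=\hat u,\qquad \big[-p\,\delta_{ij}+2\phi(I(u),|E|,\mu(u,E))\,\varepsilon_{ij}(u)\big]\nu_j\big|_{S_2}=F_i.$$ For $v,h\in X$ put $$J(v,h)=2\int_\Omega b(|E|,\mu(\tilde u+v,E))\,I(\tilde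 u+h)^{1/2}\,dx,$$ $$(L(v),h)=2\int_\Omega\psi(I(\tilde u+v),|E|,\mu(\tilde u+v,E))\,\varepsilon_{ij}(\tilde u+v)\,\varepsilon_{ij}(h)\,dx,$$ $$(K+F,h)=\int_\Omega K_ih_i\,dx+\int_{S_2}F_ih_i\,ds.$$ Theorem. If $(u,p)$ with $u=\tilde u+v$ is a regular solution, then $v\in V$ and $$J(v,h)-J(v,v)+(L(v),h-v)\ge(K+F,h-v)\qquad\text{for all }h\in V.$$ -/

import Mathlib

open MeasureTheory Set Filter Topology
open scoped ContDiff ENNReal NNReal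

namespace ERFluid

noncomputable section

/-- Euclidean space `ℝⁿ`. -/
abbrev Vec (n : ℕ) := EuclideanSpace ℝ (Fin n)

/-- The `i`-th standard basis vector. -/
def basisVec {n : ℕ} (i : Fin n) : Vec n := EuclideanSpace.single i 1

/-! ### Lipschitz boundaries, surface measure, outward normal -/

/-- A local coordinate system: an open set `U`, an orthonormal change of coordinates
`ℝⁿ⁻¹ × ℝ ≃ ℝⁿ`, and a Lipschitz function `γ` of the first `n - 1` new coordinates. -/
structure LipschitzChart (n : ℕ) where
  U : Set (Vec n)
  isOpen_U : IsOpen U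
  frame : WithLp 2 (Vec (n - 1) × ℝ) ≃ₗᵢ[ℝ] Vec n
  γ : Vec (n - 1) → ℝ
  lipschitz : ∃ K : ℝ≥0, LipschitzWith K γ

namespace LipschitzChart

variable {n : ℕ} (c : LipschitzChart n)

/-- The parametrization `y ↦ (y, γ y)` of the graph of `γ`, in the original coordinates. -/
def graphMap (y : Vec (n - 1)) : Vec n := c.frame (WithLp.toLp 2 (y, c.γ y))

/-- The (unbounded) region `{(y, t) : γ y < t}` above the graph. -/
def epigraph : Set (Vec n) :=
  {x | c.γ (c.frame.symm x).fst < (c.frame.symm x).snd}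

/-- The area element `√(1 + |∇γ|²)`. -/
def areaElement (y : Vec (n - 1)) : ℝ := Real.sqrt (1 + ‖gradient c.γ y‖ ^ 2)

/-- The surface measure `√(1 + |∇γ|²) dy` of the graph of `γ`, as a measure on `ℝⁿ`. -/
def graphMeasure : Measure (Vec n) :=
  (volume.withDensity fun y => ENNReal.ofReal (c.areaElement y)).map c.graphMap

/-- The unit normal `(∇γ, -1) / √(1 + |∇γ|²)` to the graph, pointing away from the epigraph. -/
def graphNormal (x : Vec n) : Vec n :=
  let y := (c.frame.symm x).fst
  (c.areaElement y)⁻¹ • c.frame (WithLp.toLp 2 (gradient c.γ y, -1))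

end LipschitzChart

/-- A description of the boundary of `Ω` as a Lipschitz continuous boundary: finitely many local
coordinate systems whose domains cover the boundary and in each of which `Ω` is the set above the
graph of a Lipschitz function. -/
structure LipschitzBoundary {n : ℕ} (Ω : Set (Vec n)) where
  N : ℕ
  chart : Fin N → LipschitzChart n
  cover : frontier Ω ⊆ ⋃ k, (chart k).U
  eq_epigraph : ∀ k, Ω ∩ (chart k).U = (chart k).epigraph ∩ (chart k).U

namespace LipschitzBoundary

variable {n : ℕ} {Ω : Set (Vec n)} (A : LipschitzBoundary Ω)

/-- The pieces `U_k \ ⋃_{l < k} U_l`: pairwise disjoint Borel sets that cover the boundary. -/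
def piece (k : Fin A.N) : Set (Vec n) :=
  (A.chart k).U \ ⋃ l : Fin A.N, ⋃ _ : l < k, (A.chart l).U

/-- The surface measure `ds` on the boundary, as a measure on `ℝⁿ`
(it does not depend on the coordinate systems). -/
def surfaceMeasure : Measure (Vec n) :=
  Measure.sum fun k => ((A.chart k).graphMeasure).restrict (A.piece k)

/-- The unit outward normal on the boundary, determined almost everywhere. -/
def normal (x : Vec n) : Vec n :=
  ∑ k, (A.piece k).indicator (A.chart k).graphNormal x

end LipschitzBoundary

/-- `S₁`, `S₂` are disjoint relatively open subsets of the boundary `S` of `Ω`, `S₁` is non-empty,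
`S` is the union of their closures, and `S \ (S₁ ∪ S₂)` has surface measure zero. -/
structure IsBoundarySplitting {n : ℕ} {Ω : Set (Vec n)} (A : LipschitzBoundary Ω)
    (S₁ S₂ : Set (Vec n)) : Prop where
  open_fst : ∃ O, IsOpen O ∧ S₁ = O ∩ frontier Ω
  open_snd : ∃ O, IsOpen O ∧ S₂ = O ∩ frontier Ω
  nonempty_fst : S₁.Nonempty
  disjoint : Disjoint S₁ S₂
  union_closure : closure S₁ ∪ closure S₂ = frontier Ω
  interface_null : A.surfaceMeasure (frontier Ω \ (S₁ ∪ S₂)) = 0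

/-! ### Weak derivatives, the space `H¹(Ω)`, traces

Functions on `Ω` and on its boundary are represented by functions on `ℝⁿ`; only their values
almost everywhere on `Ω`, respectively on the boundary, matter. -/

/-- `g` is the weak partial derivative `∂f/∂xᵢ` in `Ω`. -/
def IsWeakPartial {n : ℕ} (Ω : Set (Vec n)) (f : Vec n → ℝ) (i : Fin n) (g : Vec n → ℝ) : Prop :=
  ∀ φ : Vec n → ℝ, ContDiff ℝ ∞ φ → HasCompactSupport φ → tsupport φ ⊆ Ω →
    ∫ x in Ω, f x * fderiv ℝ φ x (basisVec i) = - ∫ x in Ω, g x * φ x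

/-- `f ∈ H¹(Ω)`. -/
def MemH1 {n : ℕ} (Ω : Set (Vec n)) (f : Vec n → ℝ) : Prop :=
  MemLp f 2 (volume.restrict Ω) ∧
    ∀ i, ∃ g, MemLp g 2 (volume.restrict Ω) ∧ IsWeakPartial Ω f i g

open Classical in
/-- The weak partial derivative `∂f/∂xᵢ ∈ L²(Ω)` of `f ∈ H¹(Ω)` (it is unique almost everywhere
in `Ω`). -/
def weakPartial {n : ℕ} (Ω : Set (Vec n)) (f : Vec n → ℝ) (i : Fin n) : Vec n → ℝ :=
  if h : ∃ g, MemLp g 2 (volume.restrict Ω) ∧ IsWeakPartial Ω f i g then h.choose else 0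

/-- `g ∈ L²(S)` is the trace of `f ∈ H¹(Ω)` on the boundary `S`: some sequence of smooth functions
on `ℝⁿ` converges to `f` in `H¹(Ω)` while its boundary values converge to `g` in `L²(S)`. -/
def IsTrace {n : ℕ} {Ω : Set (Vec n)} (A : LipschitzBoundary Ω) (f g : Vec n → ℝ) : Prop :=
  MemLp g 2 A.surfaceMeasure ∧
  ∃ w : ℕ → Vec n → ℝ, (∀ k, ContDiff ℝ ∞ (w k)) ∧
    Tendsto (fun k => eLpNorm (fun x => w k x - f x) 2 (volume.restrict Ω)) atTop (𝓝 0) ∧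
    (∀ i, Tendsto (fun k => eLpNorm
      (fun x => fderiv ℝ (w k) x (basisVec i) - weakPartial Ω f i x) 2 (volume.restrict Ω))
      atTop (𝓝 0)) ∧
    Tendsto (fun k => eLpNorm (fun x => w k x - g x) 2 A.surfaceMeasure) atTop (𝓝 0)

open Classical in
/-- The trace of `f ∈ H¹(Ω)` (unique almost everywhere on the boundary). -/
def trace {n : ℕ} {Ω : Set (Vec n)} (A : LipschitzBoundary Ω) (f : Vec n → ℝ) : Vec n → ℝ :=
  if h : ∃ g, IsTrace A f g then h.choose else 0

/-- `u ∈ H¹(Ω)ⁿ`. -/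
def MemH1Vec {n : ℕ} (Ω : Set (Vec n)) (u : Vec n → Vec n) : Prop :=
  ∀ i, MemH1 Ω fun x => u x i

/-- `u = ub` (the given boundary velocity) on the part `S₁` of the boundary, in the sense of traces. -/
def EqOnBoundary {n : ℕ} {Ω : Set (Vec n)} (A : LipschitzBoundary Ω) (S₁ : Set (Vec n))
    (u ub : Vec n → Vec n) : Prop :=
  ∀ i, ∃ g, IsTrace A (fun x => u x i) g ∧ ∀ᵐ x ∂(A.surfaceMeasure.restrict S₁), g x = ub x i

/-- `div u = 0` in `Ω`. -/
def DivFree {n : ℕ} (Ω : Set (Vec n)) (u : Vec n → Vec n) : Prop :=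
  ∀ᵐ x ∂(volume.restrict Ω), ∑ i, weakPartial Ω (fun z => u z i) i x = 0

/-- The space `X` of those `u ∈ H¹(Ω)ⁿ` with `u = 0` on `S₁`. -/
def X {n : ℕ} {Ω : Set (Vec n)} (A : LipschitzBoundary Ω) (S₁ : Set (Vec n)) :
    Set (Vec n → Vec n) :=
  {u | MemH1Vec Ω u ∧ EqOnBoundary A S₁ u 0}

/-- The space `V` of the divergence free elements of `X`. -/
def V {n : ℕ} {Ω : Set (Vec n)} (A : LipschitzBoundary Ω) (S₁ : Set (Vec n)) :
    Set (Vec n → Vec n) :=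
  {u | u ∈ X A S₁ ∧ DivFree Ω u}

/-! ### Kinematics -/

/-- The rate of strain tensor `ε_ij(u) = (∂u_i/∂x_j + ∂u_j/∂x_i) / 2`. -/
def strain {n : ℕ} (Ω : Set (Vec n)) (u : Vec n → Vec n) (i j : Fin n) (x : Vec n) : ℝ :=
  (weakPartial Ω (fun z => u z i) j x + weakPartial Ω (fun z => u z j) i x) / 2

/-- The second invariant `I(u) = ∑ ε_ij(u)²`. -/
def inv2 {n : ℕ} (Ω : Set (Vec n)) (u : Vec n → Vec n) (x : Vec n) : ℝ :=
  ∑ i, ∑ j, strain Ω u i j x ^ 2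

/-- The function `μ(u,E)`: the square of the scalar product of
`(α 𝟙 + u + uc) / (α √n + |u + uc|)` and `E / |E|`, where `𝟙 = (1,…,1)` and `uc` is the constant
velocity of the frame of reference. It is `0` where `E = 0`. -/
def angle {n : ℕ} (α : ℝ) (uc : Vec n) (u E : Vec n → Vec n) (x : Vec n) : ℝ :=
  (inner ℝ ((α * Real.sqrt n + ‖u x + uc‖)⁻¹ • (α • WithLp.toLp 2 (fun _ : Fin n => (1 : ℝ))
      + u x + uc)) (‖E x‖⁻¹ • E x)) ^ 2

/-! ### Material functions -/

/-- `ψ` is continuous on `ℝ₊² × [0,1]`. -/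
def ContinuousMaterial (ψ : ℝ → ℝ → ℝ → ℝ) : Prop :=
  ContinuousOn (fun y : ℝ × ℝ × ℝ => ψ y.1 y.2.1 y.2.2) (Ici 0 ×ˢ Ici 0 ×ˢ Icc 0 1)

/-- First admissible class for `ψ`: continuous, bounded between positive constants, continuously
differentiable in `y₁ ∈ [0,∞)` (one-sided at `0`), with `ψ + 2 y₁ ∂ψ/∂y₁ ≥ a₃` and
`|∂ψ/∂y₁| y₁ ≤ a₄`. -/
def DifferentiableMaterial (ψ : ℝ → ℝ → ℝ → ℝ) : Prop :=
  ContinuousMaterial ψ ∧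
  (∀ y₂ ∈ Ici (0 : ℝ), ∀ y₃ ∈ Icc (0 : ℝ) 1,
    ContDiffOn ℝ 1 (fun y₁ => ψ y₁ y₂ y₃) (Ici 0)) ∧
  ∃ a₁ a₂ a₃ a₄ : ℝ, 0 < a₁ ∧ 0 < a₂ ∧ 0 < a₃ ∧ 0 < a₄ ∧
    ∀ y₁ ∈ Ici (0 : ℝ), ∀ y₂ ∈ Ici (0 : ℝ), ∀ y₃ ∈ Icc (0 : ℝ) 1,
      a₁ ≤ ψ y₁ y₂ y₃ ∧ ψ y₁ y₂ y₃ ≤ a₂ ∧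
      a₃ ≤ ψ y₁ y₂ y₃ + 2 * derivWithin (fun y => ψ y y₂ y₃) (Ici 0) y₁ * y₁ ∧
      |derivWithin (fun y => ψ y y₂ y₃) (Ici 0) y₁| * y₁ ≤ a₄

/-- Second admissible class for `ψ`: continuous, bounded between positive constants, and
`z ↦ ψ(z²,y₂,y₃) z` is strongly increasing. -/
def StronglyMonotoneMaterial (ψ : ℝ → ℝ → ℝ → ℝ) : Prop :=
  ContinuousMaterial ψ ∧
  ∃ a₁ a₂ a₃ : ℝ, 0 < a₁ ∧ 0 < a₂ ∧ 0 < a₃ ∧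
    ∀ y₂ ∈ Ici (0 : ℝ), ∀ y₃ ∈ Icc (0 : ℝ) 1,
      (∀ y₁ ∈ Ici (0 : ℝ), a₁ ≤ ψ y₁ y₂ y₃ ∧ ψ y₁ y₂ y₃ ≤ a₂) ∧
      ∀ z₁ ∈ Ici (0 : ℝ), ∀ z₂ ∈ Ici (0 : ℝ),
        a₃ * (z₁ - z₂) ^ 2 ≤
          (ψ (z₁ ^ 2) y₂ y₃ * z₁ - ψ (z₂ ^ 2) y₂ y₃ * z₂) * (z₁ - z₂)

/-- Third admissible class for `ψ`: continuous, bounded between positive constants, and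
`z ↦ ψ(z²,y₂,y₃) z` is strictly increasing on `ℝ₊`. -/
def StrictlyMonotoneMaterial (ψ : ℝ → ℝ → ℝ → ℝ) : Prop :=
  ContinuousMaterial ψ ∧
  ∃ a₁ a₂ : ℝ, 0 < a₁ ∧ 0 < a₂ ∧
    ∀ y₂ ∈ Ici (0 : ℝ), ∀ y₃ ∈ Icc (0 : ℝ) 1,
      (∀ y₁ ∈ Ici (0 : ℝ), a₁ ≤ ψ y₁ y₂ y₃ ∧ ψ y₁ y₂ y₃ ≤ a₂) ∧
      StrictMonoOn (fun z => ψ (z ^ 2) y₂ y₃ * z) (Ici 0)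

/-- The plasticity coefficient `b` is continuous on `ℝ₊ × [0,1]` with `0 ≤ b ≤ a₅`. -/
def PlasticityCoefficient (b : ℝ → ℝ → ℝ) : Prop :=
  ContinuousOn (fun y : ℝ × ℝ => b y.1 y.2) (Ici 0 ×ˢ Icc 0 1) ∧
  ∃ a₅ : ℝ, 0 < a₅ ∧ ∀ y₁ ∈ Ici (0 : ℝ), ∀ y₂ ∈ Icc (0 : ℝ) 1, 0 ≤ b y₁ y₂ ∧ b y₁ y₂ ≤ a₅

/-- The values of the viscosity `φ(I(u),|E|,μ(u,E)) = b(|E|,μ(u,E)) / I(u)^{1/2} +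
ψ(I(u),|E|,μ(u,E))` at points where it is finite, i.e. where `I(u) ≠ 0` or `b(|E|,μ(u,E)) = 0`
(in the latter case `φ = ψ`). -/
def viscosity {n : ℕ} (Ω : Set (Vec n)) (α : ℝ) (uc : Vec n) (E : Vec n → Vec n)
    (b : ℝ → ℝ → ℝ) (ψ : ℝ → ℝ → ℝ → ℝ) (u : Vec n → Vec n) (x : Vec n) : ℝ :=
  b ‖E x‖ (angle α uc u E x) / Real.sqrt (inv2 Ω u x)
    + ψ (inv2 Ω u x) ‖E x‖ (angle α uc u E x)

/-- `(u,p)` is a regular solution of the mixed boundary value problem: `u ∈ H¹(Ω)ⁿ`, the viscosity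
is finite almost everywhere, the pressure `p` and the components `φ ε_ij(u)` are in `H¹(Ω)`, the
equations of motion and incompressibility hold almost everywhere in `Ω`, and the conditions on the
velocity on `S₁` and on the stress on `S₂` hold almost everywhere in the sense of traces. -/
structure IsRegularSolution {n : ℕ} {Ω : Set (Vec n)} (A : LipschitzBoundary Ω)
    (S₁ S₂ : Set (Vec n)) (α : ℝ) (uc : Vec n) (E : Vec n → Vec n)
    (b : ℝ → ℝ → ℝ) (ψ : ℝ → ℝ → ℝ → ℝ) (K F ub : Vec n → Vec n)
    (u : Vec n → Vec n) (p : Vec n → ℝ) : Prop where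
  velocity_mem : MemH1Vec Ω u
  viscosity_finite : ∀ᵐ x ∂(volume.restrict Ω),
    inv2 Ω u x = 0 → b ‖E x‖ (angle α uc u E x) = 0
  pressure_mem : MemH1 Ω p
  stress_mem : ∀ i j, MemH1 Ω fun x => viscosity Ω α uc E b ψ u x * strain Ω u i j x
  momentum : ∀ i, ∀ᵐ x ∂(volume.restrict Ω),
    weakPartial Ω p i x - 2 * ∑ j,
      weakPartial Ω (fun z => viscosity Ω α uc E b ψ u z * strain Ω u i j z) j x = K x i
  incompressible : DivFree Ω u
  velocity_boundary : EqOnBoundary A S₁ u ub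
  stress_boundary : ∃ (q : Vec n → ℝ) (T : Fin n → Fin n → Vec n → ℝ),
    IsTrace A p q ∧
    (∀ i j, IsTrace A (fun x => viscosity Ω α uc E b ψ u x * strain Ω u i j x) (T i j)) ∧
    ∀ i, ∀ᵐ x ∂(A.surfaceMeasure.restrict S₂),
      ∑ j, (-(q x) * (if i = j then 1 else 0) + 2 * T i j x) * A.normal x j = F x i

/-! ### The variational inequality -/

/-- `J(v,h) = 2 ∫_Ω b(|E|,μ(ut+v,E)) I(ut+h)^{1/2} dx`, where `ut` is the lift of
the boundary velocity. -/
def J {n : ℕ} (Ω : Set (Vec n)) (α : ℝ) (uc : Vec n) (E : Vec n → Vec n)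
    (b : ℝ → ℝ → ℝ) (ut v h : Vec n → Vec n) : ℝ :=
  2 * ∫ x in Ω, b ‖E x‖ (angle α uc (ut + v) E x) * Real.sqrt (inv2 Ω (ut + h) x)

/-- `(L(v),h) = 2 ∫_Ω ψ(I(ut+v),|E|,μ(ut+v,E)) ε_ij(ut+v) ε_ij(h) dx`. -/
def L {n : ℕ} (Ω : Set (Vec n)) (α : ℝ) (uc : Vec n) (E : Vec n → Vec n)
    (ψ : ℝ → ℝ → ℝ → ℝ) (ut v h : Vec n → Vec n) : ℝ :=
  2 * ∫ x in Ω, ψ (inv2 Ω (ut + v) x) ‖E x‖ (angle α uc (ut + v) E x) *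
    ∑ i, ∑ j, strain Ω (ut + v) i j x * strain Ω h i j x

/-- `(K,h) = ∫_Ω K_i h_i dx`. -/
def volumeWork {n : ℕ} (Ω : Set (Vec n)) (K h : Vec n → Vec n) : ℝ :=
  ∫ x in Ω, ∑ i, K x i * h x i

/-- `(F,h) = ∫_{S₂} F_i h_i ds`, with the trace of `h`. -/
def surfaceWork {n : ℕ} {Ω : Set (Vec n)} (A : LipschitzBoundary Ω) (S₂ : Set (Vec n))
    (F h : Vec n → Vec n) : ℝ :=
  ∫ x in S₂, ∑ i, F x i * trace A (fun z => h z i) x ∂A.surfaceMeasure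

end

end ERFluid

namespace ERFluid

/-! Put `u = ut + v`, `w = h - v`, and call `φ ε(u)` the stress. Since `w` is divergence free and
has zero trace on `S₁`, multiplying the momentum equation by `w` and integrating by parts removes
the pressure and leaves only the traction on `S₂`: the work of `K` and `F` on `w` equals `2 ∫ φ ε(u)
: ε(w)` (`work_eq_of_momentum`). The `ψ` part of `φ` gives exactly the `L` term. For the singular
part, `ε(w) = ε(ut + h) - ε(u)` and Cauchy–Schwarz give `ε(u) : ε(w) ≤ √I(u) √I(ut + h) - I(u)`;
multiplied by `b / √I(u)` this is the subgradient inequality for the convex functional `J(v, ·)`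
(`plastic_dissipation_le`), and integration yields the claim.

Most of the work is Green's formula in `H¹(Ω)` for a Lipschitz boundary (`green`). Above one
Lipschitz graph the divergence theorem follows from a vertical shear and Rademacher's theorem
(`setIntegral_fderiv_above_graph`). On the overlap of two charts both fluxes equal the same integral
over `Ω`, so the vector measures `ν ds` of the charts agree there
(`LipschitzChart.integral_mul_graphNormal_eq`); a partition of unity then gives the formula for
smooth functions on all of `Ω`. Having a trace includes, by definition, a smooth approximating
sequence, so the `H¹` formula follows by passing to the limit in each factor. The same formula
proves that traces are unique. -/

theorem integrable_of_bounded_of_eq_zero_off_compact {α : Type*} [TopologicalSpace α] [T2Space α]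
    [MeasurableSpace α] [BorelSpace α] {μ : Measure α} [IsFiniteMeasureOnCompacts μ]
    {f : α → ℝ} {K : Set α} {C : ℝ} (hf : AEStronglyMeasurable f μ) (hK : IsCompact K)
    (hz : ∀ x ∉ K, f x = 0) (hb : ∀ᵐ x ∂μ, ‖f x‖ ≤ C) : Integrable f μ := by
  have h1 : IntegrableOn f K μ :=
    Measure.integrableOn_of_bounded hK.measure_lt_top.ne hf (ae_restrict_of_ae hb)
  refine (integrableOn_iff_integrable_of_support_subset ?_).1 h1
  intro x hx
  by_contra h
  exact hx (hz x h)

theorem norm_fderiv_apply_le_of_lipschitz {E : Type*} [NormedAddCommGroup E]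
    [NormedSpace ℝ E] {γ : E → ℝ} {K : ℝ≥0} (hγ : LipschitzWith K γ) (y a : E) :
    ‖fderiv ℝ γ y a‖ ≤ K * ‖a‖ :=
  ((fderiv ℝ γ y).le_opNorm a).trans
    (mul_le_mul_of_nonneg_right (_root_.norm_fderiv_le_of_lipschitz ℝ hγ) (norm_nonneg a))

theorem exists_bound_fderiv {F : Type*} [NormedAddCommGroup F] [NormedSpace ℝ F] {G : F → ℝ}
    (hG : ContDiff ℝ 1 G) (hc : HasCompactSupport G) :
    ∃ M, 0 ≤ M ∧ ∀ z, ‖fderiv ℝ G z‖ ≤ M := by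
  obtain ⟨M, hM⟩ := (hG.continuous_fderiv (by simp)).bounded_above_of_compact_support (hc.fderiv ℝ)
  exact ⟨M, (norm_nonneg _).trans (hM 0), hM⟩

/-! ### Divergence theorem above a Lipschitz graph -/

section Graph

variable {E : Type*} [NormedAddCommGroup E] [InnerProductSpace ℝ E] [FiniteDimensional ℝ E]
  [MeasurableSpace E] [BorelSpace E]

/-- The vertical shear `(y, t) ↦ (y, γ y + t)`. -/
def verticalShear {γ : E → ℝ} (hγ : Continuous γ) : (E × ℝ) ≃ₜ (E × ℝ) where
  toFun z := (z.1, γ z.1 + z.2)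
  invFun z := (z.1, z.2 - γ z.1)
  left_inv z := by simp
  right_inv z := by simp
  continuous_toFun := by fun_prop
  continuous_invFun := by fun_prop

theorem measurePreserving_verticalShear {γ : E → ℝ} (hγ : Continuous γ) :
    MeasurePreserving (verticalShear hγ) ((volume : Measure E).prod (volume : Measure ℝ))
      ((volume : Measure E).prod (volume : Measure ℝ)) := by
  refine (MeasurePreserving.id (volume : Measure E)).skew_product
    (g := fun y t => γ y + t) ?_ (ae_of_all _ fun y => ?_)
  · have : Continuous (Function.uncurry fun (y : E) (t : ℝ) => γ y + t) := by
      unfold Function.uncurry; fun_prop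
    exact this.measurable
  · exact (measurePreserving_add_left volume (γ y)).map_eq

/-- By the chain rule, valid wherever `γ` is differentiable and so almost everywhere, the integrand
is the derivative in direction `a` of the compactly supported Lipschitz function `y ↦ G (y, γ y +
t)`. -/
theorem integral_fderiv_tangential_eq_zero {γ : E → ℝ} {K : ℝ≥0} (hγ : LipschitzWith K γ)
    {G : E × ℝ → ℝ} (hG : ContDiff ℝ 1 G) (hc : HasCompactSupport G) (a : E) (t : ℝ) :
    ∫ y, fderiv ℝ G (y, γ y + t) (a, fderiv ℝ γ y a) = 0 := by
  obtain ⟨C, hC⟩ := hG.lipschitzWith_of_hasCompactSupport hc (by simp)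
  have hlip : LipschitzWith (C * max 1 (K + 0)) (fun y => G (y, γ y + t)) :=
    hC.comp (LipschitzWith.id.prodMk (hγ.add (LipschitzWith.const t)))
  have hcomp : HasCompactSupport (fun y => G (y, γ y + t)) := by
    refine HasCompactSupport.intro (hc.isCompact.image continuous_fst) fun y hy => ?_
    by_contra h
    exact hy ⟨_, subset_tsupport _ h, rfl⟩
  -- Integration by parts against the constant `1`; the formula reverses the direction, hence `-a`.
  have h := LipschitzWith.integral_lineDeriv_mul_eq (μ := (volume : Measure E))
    (LipschitzWith.const (1 : ℝ)) hlip hcomp (-a)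
  simp only [neg_neg, mul_one] at h
  have h0 : ∀ x : E, lineDeriv ℝ (fun _ : E => (1 : ℝ)) x (-a) = 0 := fun x => by
    simp [lineDeriv]
  simp only [h0, zero_mul, integral_zero] at h
  rw [h]
  refine integral_congr_ae ?_
  filter_upwards [hγ.ae_differentiableAt (μ := volume)] with y hy
  have hd : HasFDerivAt (fun y => G (y, γ y + t))
      ((fderiv ℝ G (y, γ y + t)).comp ((ContinuousLinearMap.id ℝ E).prod (fderiv ℝ γ y))) y :=
    ((hG.differentiable (by simp)) (y, γ y + t)).hasFDerivAt.comp y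
      ((hasFDerivAt_id y).prodMk (hy.hasFDerivAt.add_const t))
  rw [hd.differentiableAt.lineDeriv_eq_fderiv, hd.fderiv]
  simp

/-- The divergence theorem above the graph of a Lipschitz function. -/
theorem setIntegral_fderiv_above_graph {γ : E → ℝ} {K : ℝ≥0} (hγ : LipschitzWith K γ)
    {G : E × ℝ → ℝ} (hG : ContDiff ℝ 1 G) (hc : HasCompactSupport G) (a : E) (s : ℝ) :
    ∫ z in {z : E × ℝ | γ z.1 < z.2}, fderiv ℝ G z (a, s)
        ∂((volume : Measure E).prod (volume : Measure ℝ)) =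
      ∫ y, G (y, γ y) * (fderiv ℝ γ y a - s) := by
  have hγc := hγ.continuous
  set T := verticalShear hγc
  set ν : Measure ℝ := volume.restrict (Ioi 0) with hν
  have hdG : Continuous (fderiv ℝ G) := hG.continuous_fderiv (by simp)
  have hcd : HasCompactSupport (fderiv ℝ G) := hc.fderiv ℝ
  obtain ⟨M, hM0, hM⟩ := exists_bound_fderiv hG hc
  have hKc : IsCompact (T ⁻¹' (tsupport (fderiv ℝ G))) :=
    (T.isCompact_preimage).2 hcd
  have hzero : ∀ z ∉ T ⁻¹' (tsupport (fderiv ℝ G)), fderiv ℝ G (z.1, γ z.1 + z.2) = 0 :=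
    fun z hz => image_eq_zero_of_notMem_tsupport hz
  have hmeasT : Measurable fun z : E × ℝ => fderiv ℝ G (z.1, γ z.1 + z.2) :=
    (hdG.comp T.continuous).measurable
  have hmγ : Measurable fun z : E × ℝ => fderiv ℝ γ z.1 a :=
    (measurable_fderiv_apply_const ℝ γ a).comp measurable_fst
  have happ : Continuous fun q : ((E × ℝ) →L[ℝ] ℝ) × (E × ℝ) => q.1 q.2 :=
    isBoundedBilinearMap_apply.continuous
  -- the shifted integral
  have h1 : ∫ z in {z : E × ℝ | γ z.1 < z.2}, fderiv ℝ G z (a, s)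
        ∂((volume : Measure E).prod (volume : Measure ℝ)) =
      ∫ z, fderiv ℝ G (z.1, γ z.1 + z.2) (a, s) ∂((volume : Measure E).prod ν) := by
    rw [← (measurePreserving_verticalShear hγc).setIntegral_preimage_emb
      T.toMeasurableEquiv.measurableEmbedding]
    have : (verticalShear hγc) ⁻¹' {z : E × ℝ | γ z.1 < z.2} = univ ×ˢ Ioi (0 : ℝ) := by
      ext z
      simp [verticalShear]
    rw [this, ← Measure.prod_restrict, Measure.restrict_univ]
    rfl
  have hP : Integrable (fun z : E × ℝ =>
      fderiv ℝ G (z.1, γ z.1 + z.2) (a, fderiv ℝ γ z.1 a)) ((volume : Measure E).prod ν) := by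
    refine Integrable.mono_measure (ν := (volume : Measure E).prod volume) ?_
      (Measure.prod_mono le_rfl Measure.restrict_le_self)
    refine integrable_of_bounded_of_eq_zero_off_compact
      (C := M * max ‖a‖ (K * ‖a‖)) ?_ hKc (fun z hz => by rw [hzero z hz]; rfl)
      (ae_of_all _ fun z => ?_)
    · exact (happ.measurable.comp
        (hmeasT.prodMk (measurable_const.prodMk hmγ))).aestronglyMeasurable
    · refine ((fderiv ℝ G _).le_opNorm _).trans (mul_le_mul (hM _) ?_ (norm_nonneg _) hM0)
      exact max_le_max le_rfl (norm_fderiv_apply_le_of_lipschitz hγ _ _)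
  have hQ : Integrable (fun z : E × ℝ =>
      (s - fderiv ℝ γ z.1 a) * fderiv ℝ G (z.1, γ z.1 + z.2) (0, 1))
      ((volume : Measure E).prod ν) := by
    refine Integrable.mono_measure (ν := (volume : Measure E).prod volume) ?_
      (Measure.prod_mono le_rfl Measure.restrict_le_self)
    refine integrable_of_bounded_of_eq_zero_off_compact
      (C := (‖s‖ + K * ‖a‖) * (M * ‖((0 : E), (1 : ℝ))‖)) ?_ hKc
      (fun z hz => by rw [hzero z hz]; simp) (ae_of_all _ fun z => ?_)
    · exact ((measurable_const.sub hmγ).mul (happ.measurable.comp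
        (hmeasT.prodMk measurable_const))).aestronglyMeasurable
    · rw [norm_mul]
      refine mul_le_mul ((norm_sub_le _ _).trans (add_le_add le_rfl
        (norm_fderiv_apply_le_of_lipschitz hγ _ _))) ?_ (norm_nonneg _) (by positivity)
      exact ((fderiv ℝ G _).le_opNorm _).trans (mul_le_mul_of_nonneg_right (hM _) (norm_nonneg _))
  -- Split `(a, s)` into a vector tangent to the shifted graph and a vertical remainder. The
  -- tangential part is integrated in `y` first and vanishes; the vertical part is integrated in `t`
  -- first and leaves the boundary value at `t = 0`.
  have h2 : ∀ z : E × ℝ, fderiv ℝ G (z.1, γ z.1 + z.2) (a, s) =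
      fderiv ℝ G (z.1, γ z.1 + z.2) (a, fderiv ℝ γ z.1 a) +
        (s - fderiv ℝ γ z.1 a) * fderiv ℝ G (z.1, γ z.1 + z.2) (0, 1) := by
    intro z
    rw [← smul_eq_mul, ← map_smul, ← map_add]
    simp
  rw [h1, integral_congr_ae (ae_of_all _ h2), integral_add hP hQ, integral_prod_symm _ hP,
    integral_prod _ hQ]
  simp only [integral_fderiv_tangential_eq_zero hγ hG hc a, integral_zero, zero_add]
  refine integral_congr_ae (ae_of_all _ fun y => ?_)
  simp only [integral_const_mul]
  have hf : ContDiff ℝ 1 (fun t : ℝ => G (y, γ y + t)) := hG.comp (by fun_prop)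
  have hfc : HasCompactSupport (fun t : ℝ => G (y, γ y + t)) := by
    refine HasCompactSupport.intro
      ((hc.isCompact.image continuous_snd).image (continuous_sub_right (γ y))) fun t ht => ?_
    by_contra h
    exact ht ⟨_, ⟨_, subset_tsupport _ h, rfl⟩, by simp⟩
  have hd : ∀ t : ℝ, deriv (fun t : ℝ => G (y, γ y + t)) t = fderiv ℝ G (y, γ y + t) (0, 1) := by
    intro t
    have := ((hG.differentiable (by simp)) (y, γ y + t)).hasFDerivAt.comp_hasDerivAt t
      ((hasDerivAt_const t y).prodMk ((hasDerivAt_id t).const_add (γ y)))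
    exact this.deriv
  have := hfc.integral_Ioi_deriv_eq hf 0
  simp only [hd, add_zero] at this
  rw [hν, this]
  ring

end Graph

/-! ### Surface measure and normal of a single chart -/

namespace LipschitzChart

variable {n : ℕ} (c : LipschitzChart n)

theorem continuous_γ : Continuous c.γ := by
  obtain ⟨K, hK⟩ := c.lipschitz
  exact hK.continuous

theorem continuous_graphMap : Continuous c.graphMap := by
  have := c.continuous_γ
  unfold graphMap
  fun_prop

theorem measurable_gradient : Measurable (gradient c.γ) :=
  ((InnerProductSpace.toDual ℝ (Vec (n - 1))).symm.continuous.measurable).comp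
    (measurable_fderiv ℝ c.γ)

theorem measurable_areaElement : Measurable c.areaElement := by
  have := c.measurable_gradient
  unfold areaElement
  fun_prop

theorem areaElement_pos (y : Vec (n - 1)) : 0 < c.areaElement y :=
  Real.sqrt_pos.2 (by positivity)

theorem measurable_graphNormal : Measurable c.graphNormal := by
  have h1 : Measurable fun x : Vec n => (c.frame.symm x).fst := by
    have : Continuous fun x : Vec n => (c.frame.symm x).fst := by fun_prop
    exact this.measurable
  have h2 : Continuous fun q : Vec (n - 1) × ℝ => c.frame (WithLp.toLp 2 q) := by fun_prop
  exact ((c.measurable_areaElement.comp h1).inv).smul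
    (h2.measurable.comp ((c.measurable_gradient.comp h1).prodMk measurable_const))

theorem norm_graphNormal (x : Vec n) : ‖c.graphNormal x‖ = 1 := by
  have hpos := c.areaElement_pos (c.frame.symm x).fst
  have : ‖c.frame (WithLp.toLp 2 (gradient c.γ (c.frame.symm x).fst, (-1 : ℝ)))‖ =
      c.areaElement (c.frame.symm x).fst := by
    rw [LinearIsometryEquiv.norm_map, WithLp.prod_norm_eq_of_L2, areaElement, add_comm]
    simp
  rw [graphNormal, norm_smul, this, norm_inv, Real.norm_of_nonneg hpos.le,
    inv_mul_cancel₀ hpos.ne']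

theorem exists_areaElement_le : ∃ C : ℝ, ∀ y, c.areaElement y ≤ C := by
  obtain ⟨K, hK⟩ := c.lipschitz
  refine ⟨Real.sqrt (1 + (K : ℝ) ^ 2), fun y => Real.sqrt_le_sqrt ?_⟩
  have : ‖gradient c.γ y‖ ≤ K := by
    rw [gradient, LinearIsometryEquiv.norm_map]
    exact norm_fderiv_le_of_lipschitz ℝ hK
  gcongr

/-- The area element is bounded because `γ` is Lipschitz, and the parameters of graph points in a
compact set lie in the compact projection of that set. -/
instance isFiniteMeasureOnCompacts_graphMeasure : IsFiniteMeasureOnCompacts c.graphMeasure := by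
  refine ⟨fun B hB => ?_⟩
  obtain ⟨C, hC⟩ := c.exists_areaElement_le
  have hpre : MeasurableSet (c.graphMap ⁻¹' B) :=
    c.continuous_graphMap.measurable hB.measurableSet
  rw [graphMeasure, Measure.map_apply c.continuous_graphMap.measurable hB.measurableSet,
    withDensity_apply _ hpre]
  have hcont : Continuous fun x : Vec n => (c.frame.symm x).fst := by fun_prop
  have hsub : c.graphMap ⁻¹' B ⊆ (fun x : Vec n => (c.frame.symm x).fst) '' B := by
    intro y hy
    exact ⟨_, hy, by simp [graphMap]⟩
  calc ∫⁻ y in c.graphMap ⁻¹' B, ENNReal.ofReal (c.areaElement y)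
      ≤ ∫⁻ _ in c.graphMap ⁻¹' B, ENNReal.ofReal C :=
        lintegral_mono fun y => ENNReal.ofReal_le_ofReal (hC y)
    _ = ENNReal.ofReal C * volume (c.graphMap ⁻¹' B) := by simp
    _ < ⊤ := ENNReal.mul_lt_top ENNReal.ofReal_lt_top
        ((measure_mono hsub).trans_lt (hB.image hcont).measure_lt_top)

theorem integral_graphMeasure {f : Vec n → ℝ} (hf : Measurable f) :
    ∫ x, f x ∂c.graphMeasure = ∫ y, c.areaElement y * f (c.graphMap y) := by
  rw [graphMeasure, integral_map c.continuous_graphMap.aemeasurable hf.aestronglyMeasurable,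
    integral_withDensity_eq_integral_toReal_smul c.measurable_areaElement.ennreal_ofReal
      (ae_of_all _ fun _ => ENNReal.ofReal_lt_top)]
  refine integral_congr_ae (ae_of_all _ fun y => ?_)
  simp [ENNReal.toReal_ofReal (c.areaElement_pos y).le]

/-- The coordinates `(y, t) ↦ frame (y, t)` as a measure preserving map. -/
theorem measurePreserving_frame :
    MeasurePreserving (fun z : Vec (n - 1) × ℝ => c.frame (WithLp.toLp 2 z)) volume volume :=
  c.frame.measurePreserving.comp (WithLp.volume_preserving_toLp (Vec (n - 1)) ℝ)

/-- The area element cancels the normalization of the normal. What remains is the boundary density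
in `setIntegral_fderiv_above_graph` for the direction of the `i`-th basis vector in the frame. -/
theorem area_mul_graphNormal (y : Vec (n - 1)) (i : Fin n) :
    c.areaElement y * c.graphNormal (c.graphMap y) i =
      fderiv ℝ c.γ y (c.frame.symm (basisVec i)).fst - (c.frame.symm (basisVec i)).snd := by
  have h1 : c.graphNormal (c.graphMap y) =
      (c.areaElement y)⁻¹ • c.frame (WithLp.toLp 2 (gradient c.γ y, (-1 : ℝ))) := by
    simp [graphNormal, graphMap]
  have h2 : ∀ z : Vec n, z i = inner ℝ z (basisVec i) := fun z => by
    simp [basisVec, EuclideanSpace.inner_single_right]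
  rw [h1, PiLp.smul_apply, smul_eq_mul, ← mul_assoc, mul_inv_cancel₀ (c.areaElement_pos y).ne',
    one_mul, h2, LinearIsometryEquiv.inner_map_eq_flip, WithLp.prod_inner_apply]
  simp only [gradient, InnerProductSpace.toDual_symm_apply]
  simp [sub_eq_add_neg]

/-- The frame is a measure preserving linear change of variables, so this is
`setIntegral_fderiv_above_graph` read in the original coordinates. -/
theorem setIntegral_epigraph_fderiv {g : Vec n → ℝ} (hg : ContDiff ℝ 1 g)
    (hc : HasCompactSupport g) (i : Fin n) :
    ∫ x in c.epigraph, fderiv ℝ g x (basisVec i) =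
      ∫ x, g x * c.graphNormal x i ∂c.graphMeasure := by
  obtain ⟨K, hK⟩ := c.lipschitz
  let e : (Vec (n - 1) × ℝ) ≃L[ℝ] Vec n :=
    (WithLp.prodContinuousLinearEquiv 2 ℝ (Vec (n - 1)) ℝ).symm.trans
      c.frame.toContinuousLinearEquiv
  have he : ∀ z, e z = c.frame (WithLp.toLp 2 z) := fun z => rfl
  have hes : ∀ x, e.symm x = ((c.frame.symm x).fst, (c.frame.symm x).snd) := fun x => rfl
  have hG : ContDiff ℝ 1 (g ∘ e) := hg.comp e.contDiff
  have hGc : HasCompactSupport (g ∘ e) := hc.comp_homeomorph e.toHomeomorph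
  have hmp : MeasurePreserving e ((volume : Measure (Vec (n - 1))).prod (volume : Measure ℝ))
    volume := c.measurePreserving_frame
  have key := setIntegral_fderiv_above_graph hK hG hGc (c.frame.symm (basisVec i)).fst
    (c.frame.symm (basisVec i)).snd
  have hmeas : Measurable fun x => g x * c.graphNormal x i :=
    hg.continuous.measurable.mul
      ((EuclideanSpace.proj (𝕜 := ℝ) i).continuous.measurable.comp c.measurable_graphNormal)
  rw [c.integral_graphMeasure hmeas, ← hmp.setIntegral_preimage_emb
    e.toHomeomorph.toMeasurableEquiv.measurableEmbedding]
  have hpre : e ⁻¹' c.epigraph = {z : Vec (n - 1) × ℝ | c.γ z.1 < z.2} := by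
    ext z
    simp [he, epigraph]
  rw [hpre]
  have hfd : ∀ z, fderiv ℝ (g ∘ e) z ((c.frame.symm (basisVec i)).fst,
      (c.frame.symm (basisVec i)).snd) = fderiv ℝ g (e z) (basisVec i) := by
    intro z
    rw [fderiv_comp z ((hg.differentiable (by simp)) _) e.differentiableAt,
      ContinuousLinearEquiv.fderiv, ContinuousLinearMap.comp_apply, ← hes]
    simp
  simp only [hfd] at key
  rw [key]
  refine integral_congr_ae (ae_of_all _ fun y => ?_)
  simp only
  rw [mul_left_comm, area_mul_graphNormal]
  rfl

end LipschitzChart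

variable {n : ℕ} {Ω : Set (Vec n)}

/-! ### Charts compared with the domain and with each other -/

namespace LipschitzChart

theorem ae_mem_graph (c : LipschitzChart n) :
    ∀ᵐ x ∂c.graphMeasure, c.γ (c.frame.symm x).fst = (c.frame.symm x).snd := by
  have hγ := c.continuous_γ
  have hcl : IsClosed {x : Vec n | c.γ (c.frame.symm x).fst = (c.frame.symm x).snd} :=
    isClosed_eq (by fun_prop) (by fun_prop)
  rw [graphMeasure, ae_map_iff c.continuous_graphMap.aemeasurable hcl.measurableSet]
  exact ae_of_all _ fun y => by simp [graphMap]

theorem isOpen_epigraph (c : LipschitzChart n) : IsOpen c.epigraph := by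
  have hγ := c.continuous_γ
  exact isOpen_lt (by fun_prop) (by fun_prop)

theorem mem_frontier_of_mem_graph (c : LipschitzChart n) (hΩ : IsOpen Ω)
    (hc : Ω ∩ c.U = c.epigraph ∩ c.U) {x : Vec n} (hxU : x ∈ c.U)
    (hx : c.γ (c.frame.symm x).fst = (c.frame.symm x).snd) : x ∈ frontier Ω := by
  rw [hΩ.frontier_eq]
  refine ⟨?_, fun h => ?_⟩
  -- Moving up from `x` along the last frame axis enters the epigraph at once and stays in `c.U` for
  -- small `s`, so `x` is a limit of points of `Ω`.
  · let z : ℝ → Vec n := fun s =>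
      c.frame (WithLp.toLp 2 ((c.frame.symm x).fst, (c.frame.symm x).snd + s))
    have hz0 : z 0 = x := by
      have : WithLp.toLp 2 ((c.frame.symm x).fst, (c.frame.symm x).snd) = c.frame.symm x := rfl
      simp [z, this]
    have hzc : Continuous z := by fun_prop
    have ht : Tendsto z (𝓝[>] 0) (𝓝 x) := by
      have := hzc.tendsto 0
      rw [hz0] at this
      exact this.mono_left nhdsWithin_le_nhds
    refine mem_closure_of_tendsto ht ?_
    filter_upwards [ht (c.isOpen_U.mem_nhds hxU), self_mem_nhdsWithin] with s hs hpos
    have : z s ∈ c.epigraph ∩ c.U := by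
      refine ⟨?_, hs⟩
      have hpos : 0 < s := hpos
      simp [epigraph, z, hx, hpos]
    rw [← hc] at this
    exact this.1
  · have : x ∈ c.epigraph ∩ c.U := hc ▸ ⟨h, hxU⟩
    exact absurd this.1 (by simp [epigraph, hx])

theorem ae_mem_frontier (c : LipschitzChart n) (hΩ : IsOpen Ω)
    (hc : Ω ∩ c.U = c.epigraph ∩ c.U) : ∀ᵐ x ∂c.graphMeasure, x ∈ c.U → x ∈ frontier Ω := by
  filter_upwards [c.ae_mem_graph] with x hx hU
  exact c.mem_frontier_of_mem_graph hΩ hc hU hx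

/-- The divergence theorem for functions supported in one coordinate neighbourhood. -/
theorem setIntegral_fderiv (c : LipschitzChart n) (hΩ : IsOpen Ω)
    (hc : Ω ∩ c.U = c.epigraph ∩ c.U) {g : Vec n → ℝ} (hg : ContDiff ℝ 1 g)
    (hgc : HasCompactSupport g) (hgU : tsupport g ⊆ c.U) (i : Fin n) :
    ∫ x in Ω, fderiv ℝ g x (basisVec i) = ∫ x, g x * c.graphNormal x i ∂c.graphMeasure := by
  rw [← c.setIntegral_epigraph_fderiv hg hgc i, ← integral_indicator hΩ.measurableSet,
    ← integral_indicator c.isOpen_epigraph.measurableSet]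
  congr 1
  ext x
  by_cases hx : x ∈ c.U
  · have : x ∈ Ω ↔ x ∈ c.epigraph :=
      ⟨fun h => (hc ▸ (⟨h, hx⟩ : x ∈ Ω ∩ c.U) : x ∈ c.epigraph ∩ c.U).1,
        fun h => (hc ▸ (⟨h, hx⟩ : x ∈ c.epigraph ∩ c.U) : x ∈ Ω ∩ c.U).1⟩
    by_cases h : x ∈ Ω
    · rw [indicator_of_mem h, indicator_of_mem (this.1 h)]
    · rw [indicator_of_notMem h, indicator_of_notMem (fun h' => h (this.2 h'))]
  · have h0 : fderiv ℝ g x = 0 := by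
      by_contra h
      exact hx (hgU (support_fderiv_subset ℝ h))
    simp [indicator, h0]

theorem measurable_graphNormal_apply (c : LipschitzChart n) (i : Fin n) :
    Measurable fun x => c.graphNormal x i :=
  (EuclideanSpace.proj (𝕜 := ℝ) i).continuous.measurable.comp c.measurable_graphNormal

theorem norm_graphNormal_apply_le (c : LipschitzChart n) (x : Vec n) (i : Fin n) :
    ‖c.graphNormal x i‖ ≤ 1 :=
  (PiLp.norm_apply_le _ i).trans (c.norm_graphNormal x).le

/-- The bounded weight `d` stands for a Radon–Nikodym density of a chart measure, or for the
constant `1`. -/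
theorem integrable_mul_graphNormal_mul (c : LipschitzChart n) {m : Measure (Vec n)}
    [IsFiniteMeasureOnCompacts m] {g d : Vec n → ℝ} (hg : Continuous g)
    (hgc : HasCompactSupport g) (hd : Measurable d) (hd1 : ∀ᵐ x ∂m, ‖d x‖ ≤ 1) (i : Fin n) :
    Integrable (fun x => d x * (g x * c.graphNormal x i)) m := by
  obtain ⟨M, hM⟩ := hgc.exists_bound_of_continuous hg
  refine integrable_of_bounded_of_eq_zero_off_compact (C := 1 * (M * 1))
    (hd.mul (hg.measurable.mul (c.measurable_graphNormal_apply i))).aestronglyMeasurable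
    hgc.isCompact (fun x hx => by simp [image_eq_zero_of_notMem_tsupport hx]) ?_
  filter_upwards [hd1] with x hx
  have hM0 : 0 ≤ M := (norm_nonneg _).trans (hM x)
  rw [norm_mul, norm_mul]
  exact mul_le_mul hx (mul_le_mul (hM x) (c.norm_graphNormal_apply_le x i) (norm_nonneg _) hM0)
    (by positivity) zero_le_one

/-- In the overlap of two coordinate neighbourhoods, the vector-valued surface measures of the
two charts coincide. -/
theorem integral_mul_graphNormal_eq (c d : LipschitzChart n) (hΩ : IsOpen Ω)
    (hc : Ω ∩ c.U = c.epigraph ∩ c.U) (hd : Ω ∩ d.U = d.epigraph ∩ d.U)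
    {g : Vec n → ℝ} (hg : ∀ x ∉ c.U ∩ d.U, g x = 0) (i : Fin n) :
    ∫ x, g x * c.graphNormal x i ∂c.graphMeasure =
      ∫ x, g x * d.graphNormal x i ∂d.graphMeasure := by
  -- The two measures have no relation known in advance; their sum dominates both, with densities at
  -- most `1`, so that equality becomes an almost everywhere identity of functions.
  set m : Measure (Vec n) := c.graphMeasure + d.graphMeasure with hm
  have : IsFiniteMeasureOnCompacts m :=
    ⟨fun B hB => by
      rw [hm, Measure.add_apply]
      exact ENNReal.add_lt_top.2 ⟨hB.measure_lt_top, hB.measure_lt_top⟩⟩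
  have hcm : c.graphMeasure ≤ m := Measure.le_add_right le_rfl
  have hdm : d.graphMeasure ≤ m := Measure.le_add_left le_rfl
  set rc : Vec n → ℝ := fun x => (c.graphMeasure.rnDeriv m x).toReal with hrc
  set rd : Vec n → ℝ := fun x => (d.graphMeasure.rnDeriv m x).toReal with hrd
  have hrcm : Measurable rc := (Measure.measurable_rnDeriv _ _).ennreal_toReal
  have hrdm : Measurable rd := (Measure.measurable_rnDeriv _ _).ennreal_toReal
  have bound : ∀ {μ : Measure (Vec n)}, μ ≤ m → ∀ᵐ x ∂m, ‖(μ.rnDeriv m x).toReal‖ ≤ 1 := by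
    intro μ hμ
    filter_upwards [Measure.rnDeriv_le_one_of_le hμ] with x hx
    rw [Real.norm_of_nonneg ENNReal.toReal_nonneg]
    exact ENNReal.toReal_le_of_le_ofReal zero_le_one (by simpa using hx)
  have hI : ∀ f : Vec n → ℝ, ∫ x, rc x * f x ∂m = ∫ x, f x ∂c.graphMeasure := fun f =>
    integral_rnDeriv_smul hcm.absolutelyContinuous
  have hJ : ∀ f : Vec n → ℝ, ∫ x, rd x * f x ∂m = ∫ x, f x ∂d.graphMeasure := fun f =>
    integral_rnDeriv_smul hdm.absolutelyContinuous
  have hloc : LocallyIntegrable (fun x => rc x * c.graphNormal x i - rd x * d.graphNormal x i)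
      m := by
    rw [locallyIntegrable_iff]
    intro B hB
    refine Measure.integrableOn_of_bounded (M := 1 * 1 + 1 * 1) hB.measure_lt_top.ne
      ((hrcm.mul (c.measurable_graphNormal_apply i)).sub
        (hrdm.mul (d.measurable_graphNormal_apply i))).aestronglyMeasurable ?_
    refine ae_restrict_of_ae ?_
    filter_upwards [bound hcm, bound hdm] with x h1 h2
    refine (norm_sub_le _ _).trans ?_
    rw [norm_mul, norm_mul]
    exact add_le_add
      (mul_le_mul h1 (c.norm_graphNormal_apply_le x i) (norm_nonneg _) zero_le_one)
      (mul_le_mul h2 (d.norm_graphNormal_apply_le x i) (norm_nonneg _) zero_le_one)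
  -- For a test function supported in both chart domains, each flux equals the integral of its
  -- `i`-th derivative over `Ω`. Hence the difference of the densities is orthogonal to all such
  -- test functions.
  have hae := (c.isOpen_U.inter d.isOpen_U).ae_eq_zero_of_integral_contDiff_smul_eq_zero
    (hloc.locallyIntegrableOn _) (fun f hf hfc hfU => by
      have e : ∀ x, f x • (rc x * c.graphNormal x i - rd x * d.graphNormal x i) =
          rc x * (f x * c.graphNormal x i) - rd x * (f x * d.graphNormal x i) := fun x => by
        rw [smul_eq_mul]; ring
      simp only [e]
      rw [integral_sub
        (c.integrable_mul_graphNormal_mul hf.continuous hfc hrcm (bound hcm) i)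
        (d.integrable_mul_graphNormal_mul hf.continuous hfc hrdm (bound hdm) i), hI, hJ,
        ← c.setIntegral_fderiv hΩ hc (hf.of_le (by exact_mod_cast le_top)) hfc
          (hfU.trans inter_subset_left),
        ← d.setIntegral_fderiv hΩ hd (hf.of_le (by exact_mod_cast le_top)) hfc
          (hfU.trans inter_subset_right), sub_self])
  rw [← hI, ← hJ]
  refine integral_congr_ae ?_
  filter_upwards [hae] with x hx
  by_cases h : x ∈ c.U ∩ d.U
  · linear_combination (g x) * hx h
  · simp [hg x h]

end LipschitzChart

/-! ### Gluing the charts: the divergence theorem in the whole domain -/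

namespace LipschitzBoundary

variable (A : LipschitzBoundary Ω)

theorem measurableSet_piece (k : Fin A.N) : MeasurableSet (A.piece k) :=
  (A.chart k).isOpen_U.measurableSet.diff
    (MeasurableSet.iUnion fun l => MeasurableSet.iUnion fun _ => (A.chart l).isOpen_U.measurableSet)

theorem piece_subset (k : Fin A.N) : A.piece k ⊆ (A.chart k).U := sdiff_subset

theorem eq_of_mem_piece {k l : Fin A.N} {x : Vec n} (hk : x ∈ A.piece k) (hl : x ∈ A.piece l) :
    k = l := by
  by_contra h
  rcases lt_or_gt_of_ne h with h | h
  · exact hl.2 (mem_iUnion₂.2 ⟨k, h, A.piece_subset k hk⟩)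
  · exact hk.2 (mem_iUnion₂.2 ⟨l, h, A.piece_subset l hl⟩)

/-- The chart of least index containing `x` works. -/
theorem exists_mem_piece {x : Vec n} (hx : x ∈ frontier Ω) : ∃ k, x ∈ A.piece k := by
  classical
  obtain ⟨k, hk⟩ := mem_iUnion.1 (A.cover hx)
  have hex : ∃ m : ℕ, ∃ h : m < A.N, x ∈ (A.chart ⟨m, h⟩).U := ⟨k, k.2, hk⟩
  obtain ⟨h1, h2⟩ := Nat.find_spec hex
  refine ⟨⟨Nat.find hex, h1⟩, h2, fun hc => ?_⟩
  obtain ⟨l, hl, hlx⟩ := mem_iUnion₂.1 hc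
  exact Nat.find_min hex hl ⟨l.2, hlx⟩

theorem sum_indicator_piece_of_mem {β : Type*} [AddCommMonoid β] (f : Fin A.N → Vec n → β)
    {k : Fin A.N} {x : Vec n} (hx : x ∈ A.piece k) :
    ∑ l, (A.piece l).indicator (f l) x = f k x := by
  rw [Finset.sum_eq_single k, indicator_of_mem hx]
  · intro l _ hl
    exact indicator_of_notMem (fun h => hl (A.eq_of_mem_piece h hx)) _
  · simp

theorem normal_of_mem_piece {k : Fin A.N} {x : Vec n} (hx : x ∈ A.piece k) :
    A.normal x = (A.chart k).graphNormal x :=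
  A.sum_indicator_piece_of_mem (fun k => (A.chart k).graphNormal) hx

theorem measurable_normal : Measurable A.normal :=
  Finset.measurable_fun_sum _ fun k _ =>
    (A.chart k).measurable_graphNormal.indicator (A.measurableSet_piece k)

theorem measurable_normal_apply (i : Fin n) : Measurable fun x => A.normal x i :=
  (EuclideanSpace.proj (𝕜 := ℝ) i).continuous.measurable.comp A.measurable_normal

theorem norm_normal_of_mem_frontier {x : Vec n} (hx : x ∈ frontier Ω) : ‖A.normal x‖ = 1 := by
  obtain ⟨k, hk⟩ := A.exists_mem_piece hx
  rw [A.normal_of_mem_piece hk, LipschitzChart.norm_graphNormal]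

theorem ae_mem_frontier (hΩ : IsOpen Ω) : ∀ᵐ x ∂A.surfaceMeasure, x ∈ frontier Ω := by
  rw [surfaceMeasure, Measure.ae_sum_iff]
  intro k
  rw [ae_restrict_iff' (A.measurableSet_piece k)]
  filter_upwards [(A.chart k).ae_mem_frontier hΩ (A.eq_epigraph k)] with x hx hp
  exact hx (A.piece_subset k hp)

theorem ae_norm_normal_apply_le (hΩ : IsOpen Ω) (i : Fin n) :
    ∀ᵐ x ∂A.surfaceMeasure, ‖A.normal x i‖ ≤ 1 := by
  filter_upwards [A.ae_mem_frontier hΩ] with x hx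
  exact (PiLp.norm_apply_le _ i).trans (A.norm_normal_of_mem_frontier hx).le

theorem isFiniteMeasure_surfaceMeasure (hΩ : IsOpen Ω) (hb : Bornology.IsBounded Ω) :
    IsFiniteMeasure A.surfaceMeasure := by
  have hcpt : IsCompact (frontier Ω) :=
    Metric.isCompact_of_isClosed_isBounded isClosed_frontier
      (hb.closure.subset frontier_subset_closure)
  refine ⟨?_⟩
  have h1 : A.surfaceMeasure univ = A.surfaceMeasure (frontier Ω) :=
    measure_congr (eventuallyEq_univ.2 (A.ae_mem_frontier hΩ)).symm
  rw [h1, surfaceMeasure, Measure.sum_apply _ isClosed_frontier.measurableSet, tsum_fintype]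
  exact ENNReal.sum_lt_top.2 fun k _ =>
    (Measure.restrict_apply_le _ _).trans_lt hcpt.measure_lt_top

theorem integral_surfaceMeasure {f : Vec n → ℝ} (hf : Integrable f A.surfaceMeasure) :
    ∫ x, f x ∂A.surfaceMeasure = ∑ k, ∫ x in A.piece k, f x ∂(A.chart k).graphMeasure := by
  rw [surfaceMeasure, integral_sum_measure hf, tsum_fintype]

theorem integrable_mul_normal (hΩ : IsOpen Ω) (hb : Bornology.IsBounded Ω) {f : Vec n → ℝ}
    (hf : Continuous f) (i : Fin n) :
    Integrable (fun x => f x * A.normal x i) A.surfaceMeasure := by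
  have := A.isFiniteMeasure_surfaceMeasure hΩ hb
  have hcpt : IsCompact (frontier Ω) :=
    Metric.isCompact_of_isClosed_isBounded isClosed_frontier
      (hb.closure.subset frontier_subset_closure)
  obtain ⟨C, hC⟩ := hcpt.exists_bound_of_continuousOn hf.continuousOn
  refine Integrable.of_bound (hf.measurable.mul (A.measurable_normal_apply i)).aestronglyMeasurable
    (C * 1) ?_
  filter_upwards [A.ae_mem_frontier hΩ, A.ae_norm_normal_apply_le hΩ i] with x hx h1
  rw [norm_mul]
  exact mul_le_mul (hC x hx) h1 (norm_nonneg _) ((norm_nonneg _).trans (hC x hx))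

/-- The surface measure uses chart `l` on piece `l`. As `g` vanishes outside the domain of chart
`k`, only overlaps with it contribute, and there `LipschitzChart.integral_mul_graphNormal_eq`
replaces chart `l` by chart `k`; the sum over the pieces is the flux in chart `k`. -/
theorem setIntegral_fderiv_of_tsupport_subset_chart (hΩ : IsOpen Ω) (hb : Bornology.IsBounded Ω)
    {g : Vec n → ℝ} (hg : ContDiff ℝ 1 g) (hgc : HasCompactSupport g) {k : Fin A.N}
    (hgU : tsupport g ⊆ (A.chart k).U) (i : Fin n) :
    ∫ x in Ω, fderiv ℝ g x (basisVec i) = ∫ x, g x * A.normal x i ∂A.surfaceMeasure := by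
  have hterm : ∀ l, ∫ x in A.piece l, g x * A.normal x i ∂(A.chart l).graphMeasure =
      ∫ x, (A.piece l).indicator g x * (A.chart k).graphNormal x i ∂(A.chart k).graphMeasure := by
    intro l
    rw [← integral_indicator (A.measurableSet_piece l),
      (A.chart k).integral_mul_graphNormal_eq (A.chart l) hΩ (A.eq_epigraph k) (A.eq_epigraph l)]
    · refine integral_congr_ae (ae_of_all _ fun x => ?_)
      by_cases hx : x ∈ A.piece l
      · simp [hx, A.normal_of_mem_piece hx]
      · simp [hx]
    · intro x hx
      by_cases hxl : x ∈ A.piece l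
      · rw [indicator_of_mem hxl]
        by_contra h
        exact hx ⟨hgU (subset_tsupport _ h), A.piece_subset l hxl⟩
      · exact indicator_of_notMem hxl _
  have hint : ∀ l, Integrable
      (fun x => (A.piece l).indicator g x * (A.chart k).graphNormal x i)
      (A.chart k).graphMeasure := by
    intro l
    have h1 := (A.chart k).integrable_mul_graphNormal_mul (m := (A.chart k).graphMeasure)
      hg.continuous hgc measurable_const (d := fun _ => 1) (ae_of_all _ fun x => by simp) i
    refine (h1.indicator (A.measurableSet_piece l)).congr (ae_of_all _ fun x => ?_)
    by_cases hx : x ∈ A.piece l <;> simp [hx]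
  rw [A.integral_surfaceMeasure (A.integrable_mul_normal hΩ hb hg.continuous i),
    Finset.sum_congr rfl fun l _ => hterm l, ← integral_finsetSum _ fun l _ => hint l,
    (A.chart k).setIntegral_fderiv hΩ (A.eq_epigraph k) hg hgc hgU]
  refine integral_congr_ae ?_
  filter_upwards [(A.chart k).ae_mem_frontier hΩ (A.eq_epigraph k)] with x hx
  rw [← Finset.sum_mul]
  -- Inside the chart domain almost every point is a boundary point, which lies in exactly one
  -- piece, so the truncations of `g` add up to `g`.
  by_cases hU : x ∈ (A.chart k).U
  · obtain ⟨l, hl⟩ := A.exists_mem_piece (hx hU)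
    rw [A.sum_indicator_piece_of_mem (fun _ => g) hl]
  · have h0 : g x = 0 := by
      by_contra h
      exact hU (hgU (subset_tsupport _ h))
    have : ∀ l, (A.piece l).indicator g x = 0 := fun l => by simp [indicator, h0]
    simp [h0, this]

theorem integral_fderiv_eq_zero {g : Vec n → ℝ} (hg : ContDiff ℝ 1 g) (hgc : HasCompactSupport g)
    (a : Vec n) : ∫ x, fderiv ℝ g x a = 0 := by
  obtain ⟨C, hC⟩ := hg.lipschitzWith_of_hasCompactSupport hgc (by simp)
  have h := LipschitzWith.integral_lineDeriv_mul_eq (μ := (volume : Measure (Vec n)))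
    (LipschitzWith.const (1 : ℝ)) hC hgc (-a)
  have h0 : ∀ x : Vec n, lineDeriv ℝ (fun _ : Vec n => (1 : ℝ)) x (-a) = 0 := fun x => by
    simp [lineDeriv]
  simp only [h0, zero_mul, integral_zero, neg_neg, mul_one] at h
  rw [h]
  refine integral_congr_ae (ae_of_all _ fun x => ?_)
  exact ((hg.differentiable (by simp)) x).lineDeriv_eq_fderiv.symm

/-- The divergence theorem in a bounded Lipschitz domain. -/
theorem setIntegral_fderiv (hΩ : IsOpen Ω) (hb : Bornology.IsBounded Ω)
    {f : Vec n → ℝ} (hf : ContDiff ℝ 1 f) (i : Fin n) :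
    ∫ x in Ω, fderiv ℝ f x (basisVec i) = ∫ x, f x * A.normal x i ∂A.surfaceMeasure := by
  obtain ⟨R, hR⟩ := hb.closure.subset_closedBall (0 : Vec n)
  -- A cutoff equal to `1` on the closure of `Ω`: it makes the localized functions compactly
  -- supported without changing `f` there.
  let η : ContDiffBump (0 : Vec n) := ⟨|R| + 1, |R| + 2, by positivity, by linarith⟩
  have hη : ∀ x ∈ closure Ω, η x = 1 := fun x hx => η.one_of_mem_closedBall
    (Metric.closedBall_subset_closedBall ((le_abs_self R).trans (by simp [η])) (hR hx))
  -- The index `none` is the interior patch `Ω`; it completes the chart domains to a cover of the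
  -- closure.
  let U : Option (Fin A.N) → Set (Vec n) := fun o => o.elim Ω fun k => (A.chart k).U
  have hUo : ∀ o, IsOpen (U o) := by
    rintro (_ | k)
    · exact hΩ
    · exact (A.chart k).isOpen_U
  have hcov : closure Ω ⊆ ⋃ o, U o := by
    intro x hx
    by_cases h : x ∈ Ω
    · exact mem_iUnion.2 ⟨none, h⟩
    · have : x ∈ frontier Ω := by
        rw [hΩ.frontier_eq]; exact ⟨hx, h⟩
      obtain ⟨k, hk⟩ := mem_iUnion.1 (A.cover this)
      exact mem_iUnion.2 ⟨some k, hk⟩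
  obtain ⟨χ, hχ⟩ := SmoothPartitionOfUnity.exists_isSubordinate (modelWithCornersSelf ℝ (Vec n))
    (isClosed_closure (s := Ω)) U hUo hcov
  let g : Option (Fin A.N) → Vec n → ℝ := fun o x => χ o x * (η x * f x)
  have hg : ∀ o, ContDiff ℝ 1 (g o) := fun o =>
    ((χ o).contMDiff.contDiff.of_le (by exact_mod_cast le_top)).mul (η.contDiff.mul hf)
  have hgc : ∀ o, HasCompactSupport (g o) := fun o =>
    (η.hasCompactSupport.mul_right).mul_left
  have hgU : ∀ o, tsupport (g o) ⊆ U o := fun o =>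
    (tsupport_mul_subset_left).trans (hχ o)
  have hsum : ∀ x ∈ closure Ω, ∑ o, g o x = f x := by
    intro x hx
    have := χ.sum_eq_one hx
    rw [finsum_eq_sum_of_fintype] at this
    simp only [g, ← Finset.sum_mul, this, hη x hx, one_mul]
  have hflux : ∀ o, ∫ x in Ω, fderiv ℝ (g o) x (basisVec i) =
      ∫ x, g o x * A.normal x i ∂A.surfaceMeasure := by
    rintro (_ | k)
    -- The interior part has no flux: it vanishes on the boundary, and its derivative integrates to
    -- zero over the whole space.
    · have hz : ∀ x ∉ Ω, g none x = 0 := fun x hx => by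
        by_contra h
        exact hx (hgU none (subset_tsupport _ h))
      rw [setIntegral_eq_integral_of_forall_compl_eq_zero, integral_fderiv_eq_zero (hg none)
        (hgc none), integral_eq_zero_of_ae]
      · filter_upwards [A.ae_mem_frontier hΩ] with x hx
        rw [hΩ.frontier_eq] at hx
        simp [hz x hx.2]
      · intro x hx
        have h0 : fderiv ℝ (g none) x = 0 := by
          by_contra h
          exact hx (hgU none (support_fderiv_subset ℝ h))
        simp [h0]
    · exact A.setIntegral_fderiv_of_tsupport_subset_chart hΩ hb (hg _) (hgc _) (hgU _) i
  have hL : ∫ x in Ω, fderiv ℝ f x (basisVec i) =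
      ∫ x in Ω, ∑ o, fderiv ℝ (g o) x (basisVec i) := by
    refine setIntegral_congr_fun hΩ.measurableSet fun x hx => ?_
    have heq : f =ᶠ[𝓝 x] fun z => ∑ o, g o z := by
      filter_upwards [hΩ.mem_nhds hx] with z hz
      rw [hsum z (subset_closure hz)]
    rw [heq.fderiv_eq, fderiv_fun_sum fun o _ => (hg o).differentiable (by simp) x]
    simp
  have hRt : ∫ x, f x * A.normal x i ∂A.surfaceMeasure =
      ∫ x, ∑ o, g o x * A.normal x i ∂A.surfaceMeasure := by
    refine integral_congr_ae ?_
    filter_upwards [A.ae_mem_frontier hΩ] with x hx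
    rw [← Finset.sum_mul, hsum x (frontier_subset_closure hx)]
  rw [hL, hRt, integral_finsetSum _ fun o _ => ?_, integral_finsetSum _ fun o _ => ?_]
  · exact Finset.sum_congr rfl fun o _ => hflux o
  · exact A.integrable_mul_normal hΩ hb (hg o).continuous i
  · exact ((((hg o).continuous_fderiv (by simp)).clm_apply
      continuous_const).integrable_of_hasCompactSupport ((hgc o).fderiv_apply ℝ _)).integrableOn

end LipschitzBoundary

/-! ### Products and limits in `L²` -/

theorem integrable_mul_of_memLp_two {α : Type*} [MeasurableSpace α] {μ : Measure α} {f g : α → ℝ}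
    (hf : MemLp f 2 μ) (hg : MemLp g 2 μ) : Integrable (fun x => f x * g x) μ :=
  hf.integrable_mul hg

/-- Continuity of the inner product of `L²`. -/
theorem tendsto_integral_mul_of_tendsto_eLpNorm {α : Type*} [MeasurableSpace α] {μ : Measure α}
    {f g : α → ℝ} {F G : ℕ → α → ℝ} (hf : MemLp f 2 μ) (hg : MemLp g 2 μ)
    (hF : ∀ k, MemLp (F k) 2 μ) (hG : ∀ k, MemLp (G k) 2 μ)
    (hFf : Tendsto (fun k => eLpNorm (fun x => F k x - f x) 2 μ) atTop (𝓝 0))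
    (hGg : Tendsto (fun k => eLpNorm (fun x => G k x - g x) 2 μ) atTop (𝓝 0)) :
    Tendsto (fun k => ∫ x, F k x * G k x ∂μ) atTop (𝓝 (∫ x, f x * g x ∂μ)) := by
  have h1 := (Lp.tendsto_Lp_iff_tendsto_eLpNorm'' F hF f hf).2 hFf
  have h2 := (Lp.tendsto_Lp_iff_tendsto_eLpNorm'' G hG g hg).2 hGg
  have e : ∀ {a b : α → ℝ} (ha : MemLp a 2 μ) (hb : MemLp b 2 μ),
      inner ℝ (ha.toLp a) (hb.toLp b) = ∫ x, a x * b x ∂μ := by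
    intro a b ha hb
    rw [L2.inner_def]
    refine integral_congr_ae ?_
    filter_upwards [ha.coeFn_toLp, hb.coeFn_toLp] with x hx hy
    rw [hx, hy]
    simp [mul_comm]
  have := h1.inner (𝕜 := ℝ) h2
  simpa only [e] using this

theorem tendsto_integral_mul_const_of_tendsto_eLpNorm {α : Type*} [MeasurableSpace α]
    {μ : Measure α} {f g : α → ℝ} {F : ℕ → α → ℝ} (hf : MemLp f 2 μ) (hg : MemLp g 2 μ)
    (hF : ∀ k, MemLp (F k) 2 μ)
    (hFf : Tendsto (fun k => eLpNorm (fun x => F k x - f x) 2 μ) atTop (𝓝 0)) :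
    Tendsto (fun k => ∫ x, F k x * g x ∂μ) atTop (𝓝 (∫ x, f x * g x ∂μ)) :=
  tendsto_integral_mul_of_tendsto_eLpNorm hf hg hF (fun _ => hg) hFf (by simp)

theorem tendsto_eLpNorm_add_const_mul {α : Type*} [MeasurableSpace α] {μ : Measure α}
    {f g : α → ℝ} {F G : ℕ → α → ℝ} (c : ℝ) (hf : AEStronglyMeasurable f μ)
    (hg : AEStronglyMeasurable g μ) (hF : ∀ k, AEStronglyMeasurable (F k) μ)
    (hG : ∀ k, AEStronglyMeasurable (G k) μ)
    (hFf : Tendsto (fun k => eLpNorm (fun x => F k x - f x) 2 μ) atTop (𝓝 0))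
    (hGg : Tendsto (fun k => eLpNorm (fun x => G k x - g x) 2 μ) atTop (𝓝 0)) :
    Tendsto (fun k => eLpNorm (fun x => (F k x + c * G k x) - (f x + c * g x)) 2 μ)
      atTop (𝓝 0) := by
  have hlim : Tendsto (fun k => eLpNorm (fun x => F k x - f x) 2 μ +
      ‖c‖ₑ * eLpNorm (fun x => G k x - g x) 2 μ) atTop (𝓝 0) := by
    have := hFf.add (ENNReal.Tendsto.const_mul (a := ‖c‖ₑ) hGg (Or.inr enorm_ne_top))
    simpa using this
  refine tendsto_of_tendsto_of_tendsto_of_le_of_le tendsto_const_nhds hlim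
    (fun _ => zero_le) fun k => ?_
  have e : (fun x => (F k x + c * G k x) - (f x + c * g x)) =
      (fun x => F k x - f x) + c • (fun x => G k x - g x) := by
    ext x
    simp only [Pi.add_apply, Pi.smul_apply, smul_eq_mul]
    ring
  simp only
  rw [e]
  refine (eLpNorm_add_le ((hF k).sub hf) (((hG k).sub hg).const_smul c) (by norm_num)).trans ?_
  rw [eLpNorm_const_smul]
  exact le_rfl

theorem isFiniteMeasure_restrict_of_isBounded (hb : Bornology.IsBounded Ω) :
    IsFiniteMeasure (volume.restrict Ω) :=
  ⟨by rw [Measure.restrict_apply_univ]; exact hb.measure_lt_top⟩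

theorem memLp_restrict_of_continuous (hΩ : IsOpen Ω) (hb : Bornology.IsBounded Ω) {f : Vec n → ℝ}
    (hf : Continuous f) : MemLp f 2 (volume.restrict Ω) := by
  have := isFiniteMeasure_restrict_of_isBounded hb
  obtain ⟨C, hC⟩ := (Metric.isCompact_of_isClosed_isBounded isClosed_closure
    hb.closure).exists_bound_of_continuousOn hf.continuousOn
  refine MemLp.of_bound hf.aestronglyMeasurable C ?_
  filter_upwards [ae_restrict_mem hΩ.measurableSet] with x hx using hC x (subset_closure hx)

theorem continuous_fderiv_basisVec {f : Vec n → ℝ} (hf : ContDiff ℝ ∞ f) (i : Fin n) :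
    Continuous fun x => fderiv ℝ f x (basisVec i) :=
  (hf.continuous_fderiv (by simp)).clm_apply continuous_const

/-! ### Weak derivatives -/

theorem MemH1.weakPartial_spec {f : Vec n → ℝ} (hf : MemH1 Ω f) (i : Fin n) :
    MemLp (weakPartial Ω f i) 2 (volume.restrict Ω) ∧
      IsWeakPartial Ω f i (weakPartial Ω f i) := by
  have h := hf.2 i
  rw [weakPartial, dif_pos h]
  exact h.choose_spec

theorem MemH1.memLp_weakPartial {f : Vec n → ℝ} (hf : MemH1 Ω f) (i : Fin n) :
    MemLp (weakPartial Ω f i) 2 (volume.restrict Ω) := (hf.weakPartial_spec i).1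

/-- The difference is orthogonal to every test function in `Ω`. This makes the chosen function
`weakPartial` computable from any other candidate. -/
theorem IsWeakPartial.ae_eq (hΩ : IsOpen Ω) (hb : Bornology.IsBounded Ω) {f g g' : Vec n → ℝ}
    {i : Fin n} (hg : MemLp g 2 (volume.restrict Ω)) (hg' : MemLp g' 2 (volume.restrict Ω))
    (h : IsWeakPartial Ω f i g) (h' : IsWeakPartial Ω f i g') :
    g =ᵐ[volume.restrict Ω] g' := by
  have := isFiniteMeasure_restrict_of_isBounded hb
  have hint : IntegrableOn (fun x => g x - g' x) Ω :=
    (hg.sub hg').integrable (by norm_num)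
  have hae := hΩ.ae_eq_zero_of_integral_contDiff_smul_eq_zero hint.locallyIntegrableOn
    (fun φ hφ hφc hφΩ => by
      rw [← setIntegral_eq_integral_of_forall_compl_eq_zero (s := Ω)]
      · have hφL := memLp_restrict_of_continuous hΩ hb hφ.continuous
        have e : ∀ x, φ x • (g x - g' x) = g x * φ x - g' x * φ x := fun x => by
          rw [smul_eq_mul]; ring
        simp only [e]
        rw [integral_sub (integrable_mul_of_memLp_two hg hφL) (integrable_mul_of_memLp_two hg' hφL)]
        have h1 := h φ hφ hφc hφΩ
        have h2 := h' φ hφ hφc hφΩ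
        linarith
      · intro x hx
        have : φ x = 0 := by
          by_contra hne
          exact hx (hφΩ (subset_tsupport _ hne))
        simp [this])
  rw [EventuallyEq, ae_restrict_iff' hΩ.measurableSet]
  filter_upwards [hae] with x hx hxΩ
  exact sub_eq_zero.1 (hx hxΩ)

/-- The constant `c` lets one statement serve both sums (`c = 1`) and differences (`c = -1`). -/
theorem IsWeakPartial.add_const_mul (hΩ : IsOpen Ω) (hb : Bornology.IsBounded Ω)
    {f f' g g' : Vec n → ℝ} {i : Fin n} (c : ℝ) (hf : MemLp f 2 (volume.restrict Ω))
    (hf' : MemLp f' 2 (volume.restrict Ω)) (hg : MemLp g 2 (volume.restrict Ω))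
    (hg' : MemLp g' 2 (volume.restrict Ω)) (h : IsWeakPartial Ω f i g)
    (h' : IsWeakPartial Ω f' i g') :
    IsWeakPartial Ω (fun x => f x + c * f' x) i (fun x => g x + c * g' x) := by
  intro φ hφ hφc hφΩ
  have hφL := memLp_restrict_of_continuous hΩ hb hφ.continuous
  have hdL := memLp_restrict_of_continuous hΩ hb (continuous_fderiv_basisVec hφ i)
  have h1 := h φ hφ hφc hφΩ
  have h2 := h' φ hφ hφc hφΩ
  simp only [add_mul, mul_assoc]
  rw [integral_add (integrable_mul_of_memLp_two hf hdL)
      ((integrable_mul_of_memLp_two hf' hdL).const_mul c),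
    integral_add (integrable_mul_of_memLp_two hg hφL)
      ((integrable_mul_of_memLp_two hg' hφL).const_mul c),
    integral_const_mul, integral_const_mul, h1, h2]
  ring

theorem MemH1.add_const_mul (hΩ : IsOpen Ω) (hb : Bornology.IsBounded Ω) {f g : Vec n → ℝ}
    (c : ℝ) (hf : MemH1 Ω f) (hg : MemH1 Ω g) : MemH1 Ω fun x => f x + c * g x :=
  ⟨hf.1.add (hg.1.const_mul c), fun i =>
    ⟨_, (hf.memLp_weakPartial i).add ((hg.memLp_weakPartial i).const_mul c),
      (hf.weakPartial_spec i).2.add_const_mul hΩ hb c hf.1 hg.1 (hf.memLp_weakPartial i)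
        (hg.memLp_weakPartial i) (hg.weakPartial_spec i).2⟩⟩

theorem weakPartial_add_const_mul (hΩ : IsOpen Ω) (hb : Bornology.IsBounded Ω) {f g : Vec n → ℝ}
    (c : ℝ) (hf : MemH1 Ω f) (hg : MemH1 Ω g) (i : Fin n) :
    weakPartial Ω (fun x => f x + c * g x) i =ᵐ[volume.restrict Ω]
      fun x => weakPartial Ω f i x + c * weakPartial Ω g i x := by
  have hs := (hf.add_const_mul hΩ hb c hg).weakPartial_spec i
  exact hs.2.ae_eq hΩ hb hs.1
    ((hf.memLp_weakPartial i).add ((hg.memLp_weakPartial i).const_mul c))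
    ((hf.weakPartial_spec i).2.add_const_mul hΩ hb c hf.1 hg.1 (hf.memLp_weakPartial i)
        (hg.memLp_weakPartial i) (hg.weakPartial_spec i).2)

theorem MemH1Vec.add (hΩ : IsOpen Ω) (hb : Bornology.IsBounded Ω) {u v : Vec n → Vec n}
    (hu : MemH1Vec Ω u) (hv : MemH1Vec Ω v) : MemH1Vec Ω (u + v) := fun i => by
  have := (hu i).add_const_mul hΩ hb 1 (hv i)
  simpa using this

theorem apply_sub_eq (u v : Vec n → Vec n) (i : Fin n) :
    (fun x => (u - v) x i) = fun x => u x i + (-1) * v x i := by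
  ext x
  simp [sub_eq_add_neg]

theorem MemH1Vec.sub (hΩ : IsOpen Ω) (hb : Bornology.IsBounded Ω) {u v : Vec n → Vec n}
    (hu : MemH1Vec Ω u) (hv : MemH1Vec Ω v) : MemH1Vec Ω (u - v) := fun i => by
  rw [apply_sub_eq]
  exact (hu i).add_const_mul hΩ hb (-1) (hv i)

theorem weakPartial_vec_sub (hΩ : IsOpen Ω) (hb : Bornology.IsBounded Ω) {u v : Vec n → Vec n}
    (hu : MemH1Vec Ω u) (hv : MemH1Vec Ω v) (i j : Fin n) :
    weakPartial Ω (fun x => (u - v) x i) j =ᵐ[volume.restrict Ω]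
      fun x => weakPartial Ω (fun x => u x i) j x - weakPartial Ω (fun x => v x i) j x := by
  rw [apply_sub_eq]
  filter_upwards [weakPartial_add_const_mul hΩ hb (-1) (hu i) (hv i) j] with x hx
  rw [hx]
  ring

theorem DivFree.sub (hΩ : IsOpen Ω) (hb : Bornology.IsBounded Ω) {u v : Vec n → Vec n}
    (hu : MemH1Vec Ω u) (hv : MemH1Vec Ω v) (hdu : DivFree Ω u) (hdv : DivFree Ω v) :
    DivFree Ω (u - v) := by
  have h := ae_all_iff.2 fun i => weakPartial_vec_sub hΩ hb hu hv i i
  filter_upwards [h, hdu, hdv] with x hx h1 h2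
  rw [Finset.sum_congr rfl fun i _ => hx i, Finset.sum_sub_distrib, h1, h2, sub_zero]

theorem strain_sub (hΩ : IsOpen Ω) (hb : Bornology.IsBounded Ω) {u v : Vec n → Vec n}
    (hu : MemH1Vec Ω u) (hv : MemH1Vec Ω v) :
    ∀ᵐ x ∂(volume.restrict Ω), ∀ i j,
      strain Ω (u - v) i j x = strain Ω u i j x - strain Ω v i j x := by
  have h := ae_all_iff.2 fun i => ae_all_iff.2 fun j => weakPartial_vec_sub hΩ hb hu hv i j
  filter_upwards [h] with x hx i j
  rw [strain, hx i j, hx j i, strain, strain]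
  ring

theorem MemH1Vec.memLp_strain {u : Vec n → Vec n} (hu : MemH1Vec Ω u) (i j : Fin n) :
    MemLp (strain Ω u i j) 2 (volume.restrict Ω) := by
  have := (((hu i).memLp_weakPartial j).add ((hu j).memLp_weakPartial i)).const_mul (2⁻¹ : ℝ)
  refine this.ae_eq (ae_of_all _ fun x => ?_)
  simp only [strain, Pi.add_apply]
  ring

/-! ### Traces and Green's formula -/

section Trace

variable (A : LipschitzBoundary Ω)

theorem memLp_surface_of_continuous (hΩ : IsOpen Ω) (hb : Bornology.IsBounded Ω) {f : Vec n → ℝ}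
    (hf : Continuous f) : MemLp f 2 A.surfaceMeasure := by
  have := A.isFiniteMeasure_surfaceMeasure hΩ hb
  obtain ⟨C, hC⟩ := (Metric.isCompact_of_isClosed_isBounded isClosed_frontier
    (hb.closure.subset frontier_subset_closure)).exists_bound_of_continuousOn hf.continuousOn
  refine MemLp.of_bound hf.aestronglyMeasurable C ?_
  filter_upwards [A.ae_mem_frontier hΩ] with x hx using hC x hx

theorem memLp_mul_normal (hΩ : IsOpen Ω) {f : Vec n → ℝ} (hf : MemLp f 2 A.surfaceMeasure)
    (i : Fin n) : MemLp (fun x => f x * A.normal x i) 2 A.surfaceMeasure := by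
  refine hf.mono (hf.1.mul (A.measurable_normal_apply i).aestronglyMeasurable) ?_
  filter_upwards [A.ae_norm_normal_apply_le hΩ i] with x hx
  rw [norm_mul]
  exact mul_le_of_le_one_right (norm_nonneg _) hx

theorem green_smooth (hΩ : IsOpen Ω) (hb : Bornology.IsBounded Ω) {w z : Vec n → ℝ}
    (hw : ContDiff ℝ ∞ w) (hz : ContDiff ℝ ∞ z) (i : Fin n) :
    (∫ x in Ω, fderiv ℝ w x (basisVec i) * z x) + ∫ x in Ω, w x * fderiv ℝ z x (basisVec i) =
      ∫ x, w x * (z x * A.normal x i) ∂A.surfaceMeasure := by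
  have hmem := fun {f : Vec n → ℝ} (hf : Continuous f) => memLp_restrict_of_continuous hΩ hb hf
  have h := A.setIntegral_fderiv hΩ hb
    ((hw.mul hz).of_le (by exact_mod_cast le_top) : ContDiff ℝ 1 fun x => w x * z x) i
  simp only [mul_assoc] at h
  rw [← h, ← integral_add
    (integrable_mul_of_memLp_two (hmem (continuous_fderiv_basisVec hw i)) (hmem hz.continuous))
    (integrable_mul_of_memLp_two (hmem hw.continuous) (hmem (continuous_fderiv_basisVec hz i)))]
  refine integral_congr_ae (ae_of_all _ fun x => ?_)
  simp only
  rw [fderiv_fun_mul (hw.differentiable (by simp) x) (hz.differentiable (by simp) x)]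
  simp
  ring

variable {A}

/-- First of two limits: only `f` is approximated, along the sequence that defines its trace. The
second limit, in the other factor, is taken in `green`. -/
theorem green_of_smooth_right (hΩ : IsOpen Ω) (hb : Bornology.IsBounded Ω) {f q z : Vec n → ℝ}
    (hf : MemH1 Ω f) (hq : IsTrace A f q) (hz : ContDiff ℝ ∞ z) (i : Fin n) :
    (∫ x in Ω, weakPartial Ω f i x * z x) + ∫ x in Ω, f x * fderiv ℝ z x (basisVec i) =
      ∫ x, q x * (z x * A.normal x i) ∂A.surfaceMeasure := by
  obtain ⟨hqL, w, hw, h1, h2, h3⟩ := hq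
  have hmem := fun {f : Vec n → ℝ} (hf : Continuous f) => memLp_restrict_of_continuous hΩ hb hf
  have l1 := tendsto_integral_mul_const_of_tendsto_eLpNorm (hf.memLp_weakPartial i)
    (hmem hz.continuous) (fun k => hmem (continuous_fderiv_basisVec (hw k) i)) (h2 i)
  have l2 := tendsto_integral_mul_const_of_tendsto_eLpNorm hf.1
    (hmem (continuous_fderiv_basisVec hz i)) (fun k => hmem (hw k).continuous) h1
  have l3 := tendsto_integral_mul_const_of_tendsto_eLpNorm hqL
    (memLp_mul_normal A hΩ (memLp_surface_of_continuous A hΩ hb hz.continuous) i)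
    (fun k => memLp_surface_of_continuous A hΩ hb (hw k).continuous) h3
  refine tendsto_nhds_unique (l1.add l2) (l3.congr fun k => ?_)
  exact (green_smooth A hΩ hb (hw k) hz i).symm

/-- Green's formula in `H¹(Ω)`. -/
theorem green (hΩ : IsOpen Ω) (hb : Bornology.IsBounded Ω) {f q h g : Vec n → ℝ}
    (hf : MemH1 Ω f) (hq : IsTrace A f q) (hh : MemH1 Ω h) (hg : IsTrace A h g) (i : Fin n) :
    (∫ x in Ω, weakPartial Ω f i x * h x) + ∫ x in Ω, f x * weakPartial Ω h i x =
      ∫ x, q x * A.normal x i * g x ∂A.surfaceMeasure := by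
  obtain ⟨hgL, z, hz, h1, h2, h3⟩ := hg
  have hmem := fun {f : Vec n → ℝ} (hf : Continuous f) => memLp_restrict_of_continuous hΩ hb hf
  have l1 := tendsto_integral_mul_const_of_tendsto_eLpNorm hh.1 (hf.memLp_weakPartial i)
    (fun k => hmem (hz k).continuous) h1
  have l2 := tendsto_integral_mul_const_of_tendsto_eLpNorm (hh.memLp_weakPartial i) hf.1
    (fun k => hmem (continuous_fderiv_basisVec (hz k) i)) (h2 i)
  have l3 := tendsto_integral_mul_const_of_tendsto_eLpNorm hgL (memLp_mul_normal A hΩ hq.1 i)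
    (fun k => memLp_surface_of_continuous A hΩ hb (hz k).continuous) h3
  have key : ∀ k, ∫ x, z k x * (q x * A.normal x i) ∂A.surfaceMeasure =
      (∫ x in Ω, z k x * weakPartial Ω f i x) +
        ∫ x in Ω, fderiv ℝ (z k) x (basisVec i) * f x := fun k => by
    have := green_of_smooth_right hΩ hb hf hq (hz k) i
    simp only [mul_comm (z k _) (weakPartial _ _ _ _), mul_comm (fderiv ℝ (z k) _ _) (f _)]
    rw [this]
    exact integral_congr_ae (ae_of_all _ fun x => by ring)
  have := tendsto_nhds_unique (l1.add l2) (l3.congr key)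
  simp only [mul_comm (h _) (weakPartial _ _ _ _), mul_comm (weakPartial Ω h _ _) (f _),
    mul_comm (g _)] at this
  exact this

/-- Green's formula against smooth functions expresses `∫ q φ νᵢ ds` through `f` alone, so `(q - q')
νᵢ = 0` for every `i`; and `ν` is a unit vector, so some component is nonzero. -/
theorem IsTrace.ae_eq (hΩ : IsOpen Ω) (hb : Bornology.IsBounded Ω) {f q q' : Vec n → ℝ}
    (hf : MemH1 Ω f) (hq : IsTrace A f q) (hq' : IsTrace A f q') :
    q =ᵐ[A.surfaceMeasure] q' := by
  have := A.isFiniteMeasure_surfaceMeasure hΩ hb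
  have h : ∀ i, ∀ᵐ x ∂A.surfaceMeasure, (q x - q' x) * A.normal x i = 0 := by
    intro i
    have hL := memLp_mul_normal A hΩ (f := fun x => q x - q' x) (hq.1.sub hq'.1) i
    refine ae_eq_zero_of_integral_contDiff_smul_eq_zero
      (hL.integrable (by norm_num)).locallyIntegrable fun φ hφ _ => ?_
    have h1 := green_of_smooth_right hΩ hb hf hq hφ i
    have h2 := green_of_smooth_right hΩ hb hf hq' hφ i
    have hφL := memLp_mul_normal A hΩ (memLp_surface_of_continuous A hΩ hb hφ.continuous) i
    have e : ∀ x, φ x • ((q x - q' x) * A.normal x i) =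
        q x * (φ x * A.normal x i) - q' x * (φ x * A.normal x i) := fun x => by
      rw [smul_eq_mul]; ring
    simp only [e]
    rw [integral_sub (integrable_mul_of_memLp_two hq.1 hφL)
      (integrable_mul_of_memLp_two hq'.1 hφL), ← h1, ← h2, sub_self]
  filter_upwards [ae_all_iff.2 h, A.ae_mem_frontier hΩ] with x hx hxf
  have hν : A.normal x ≠ 0 := by
    rw [← norm_ne_zero_iff, A.norm_normal_of_mem_frontier hxf]
    exact one_ne_zero
  obtain ⟨i, hi⟩ : ∃ i, A.normal x i ≠ 0 := by
    by_contra! hall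
    exact hν (by ext i; simpa using hall i)
  exact sub_eq_zero.1 ((mul_eq_zero.1 (hx i)).resolve_right hi)

theorem IsTrace.add_const_mul (hΩ : IsOpen Ω) (hb : Bornology.IsBounded Ω) {f q h g : Vec n → ℝ}
    (c : ℝ) (hf : MemH1 Ω f) (hq : IsTrace A f q) (hh : MemH1 Ω h) (hg : IsTrace A h g) :
    IsTrace A (fun x => f x + c * h x) (fun x => q x + c * g x) := by
  obtain ⟨hqL, w, hw, h1, h2, h3⟩ := hq
  obtain ⟨hgL, z, hz, h1', h2', h3'⟩ := hg
  refine ⟨hqL.add (hgL.const_mul c), fun k x => w k x + c * z k x,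
    fun k => (hw k).add (contDiff_const.mul (hz k)), ?_, fun i => ?_, ?_⟩
  · exact tendsto_eLpNorm_add_const_mul c hf.1.1 hh.1.1
      (fun k => (hw k).continuous.aestronglyMeasurable)
      (fun k => (hz k).continuous.aestronglyMeasurable) h1 h1'
  · refine (tendsto_eLpNorm_add_const_mul c (hf.memLp_weakPartial i).1 (hh.memLp_weakPartial i).1
      (fun k => (continuous_fderiv_basisVec (hw k) i).aestronglyMeasurable)
      (fun k => (continuous_fderiv_basisVec (hz k) i).aestronglyMeasurable)
      (h2 i) (h2' i)).congr fun k => eLpNorm_congr_ae ?_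
    filter_upwards [weakPartial_add_const_mul hΩ hb c hf hh i] with x hx
    rw [hx, fderiv_fun_add ((hw k).differentiable (by simp) x)
      (((hz k).differentiable (by simp) x).const_mul c),
      fderiv_const_mul ((hz k).differentiable (by simp) x)]
    simp
  · exact tendsto_eLpNorm_add_const_mul c hqL.1 hgL.1
      (fun k => (hw k).continuous.aestronglyMeasurable)
      (fun k => (hz k).continuous.aestronglyMeasurable) h3 h3'

theorem IsTrace.isTrace_trace {f g : Vec n → ℝ} (h : IsTrace A f g) :
    IsTrace A f (trace A f) := by
  have hex : ∃ g, IsTrace A f g := ⟨g, h⟩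
  rw [trace, dif_pos hex]
  exact hex.choose_spec

theorem EqOnBoundary.sub (hΩ : IsOpen Ω) (hb : Bornology.IsBounded Ω) {S : Set (Vec n)}
    {u v ub vb : Vec n → Vec n} (hu : MemH1Vec Ω u) (hv : MemH1Vec Ω v)
    (hub : EqOnBoundary A S u ub) (hvb : EqOnBoundary A S v vb) :
    EqOnBoundary A S (u - v) (ub - vb) := fun i => by
  obtain ⟨q, hq, hqe⟩ := hub i
  obtain ⟨g, hg, hge⟩ := hvb i
  rw [apply_sub_eq]
  refine ⟨_, hq.add_const_mul hΩ hb (-1) (hu i) (hv i) hg, ?_⟩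
  filter_upwards [hqe, hge] with x h1 h2
  rw [h1, h2]
  simp [sub_eq_add_neg]

theorem sub_mem_V (hΩ : IsOpen Ω) (hb : Bornology.IsBounded Ω) {S : Set (Vec n)}
    {u v ub : Vec n → Vec n} (hu : MemH1Vec Ω u) (hv : MemH1Vec Ω v)
    (hub : EqOnBoundary A S u ub) (hvb : EqOnBoundary A S v ub) (hdu : DivFree Ω u)
    (hdv : DivFree Ω v) : u - v ∈ V A S := by
  refine ⟨⟨hu.sub hΩ hb hv, ?_⟩, hdu.sub hΩ hb hu hv hdv⟩
  have := hub.sub hΩ hb hu hv hvb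
  rwa [sub_self] at this

end Trace

/-! ### Weak form of the balance of momentum -/

section WeakForm

variable {A : LipschitzBoundary Ω} {S₁ S₂ : Set (Vec n)}

theorem IsBoundarySplitting.measurableSet_snd (hS : IsBoundarySplitting A S₁ S₂) :
    MeasurableSet S₂ := by
  obtain ⟨O, hO, h⟩ := hS.open_snd
  rw [h]
  exact hO.measurableSet.inter isClosed_frontier.measurableSet

theorem IsBoundarySplitting.measurableSet_fst (hS : IsBoundarySplitting A S₁ S₂) :
    MeasurableSet S₁ := by
  obtain ⟨O, hO, h⟩ := hS.open_fst
  rw [h]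
  exact hO.measurableSet.inter isClosed_frontier.measurableSet

theorem IsBoundarySplitting.ae_mem (hS : IsBoundarySplitting A S₁ S₂) (hΩ : IsOpen Ω) :
    ∀ᵐ x ∂A.surfaceMeasure, x ∈ S₁ ∨ x ∈ S₂ := by
  filter_upwards [A.ae_mem_frontier hΩ, measure_eq_zero_iff_ae_notMem.1 hS.interface_null]
    with x hx hn
  by_contra h
  exact hn ⟨hx, h⟩

theorem isTrace_trace_of_mem_V {w : Vec n → Vec n} (hw : w ∈ V A S₁) (i : Fin n) :
    IsTrace A (fun x => w x i) (trace A fun x => w x i) := by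
  obtain ⟨g, hg, -⟩ := hw.1.2 i
  exact hg.isTrace_trace

/-- Membership in `V` only provides some trace that vanishes on `S₁`; uniqueness carries this over
to the chosen `trace`. -/
theorem trace_ae_eq_zero_of_mem_V (hΩ : IsOpen Ω) (hb : Bornology.IsBounded Ω)
    (hS : IsBoundarySplitting A S₁ S₂) {w : Vec n → Vec n} (hw : w ∈ V A S₁) (i : Fin n) :
    ∀ᵐ x ∂A.surfaceMeasure, x ∈ S₁ → trace A (fun x => w x i) x = 0 := by
  obtain ⟨g, hg, hg0⟩ := hw.1.2 i
  rw [ae_restrict_iff' hS.measurableSet_fst] at hg0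
  filter_upwards [hg0, hg.isTrace_trace.ae_eq hΩ hb (hw.1.1 i) hg] with x h0 he hx
  rw [he, h0 hx]
  simp

/-- The weak form of the balance of momentum with symmetric stress deviator `2 σ`, pressure `p` and
prescribed surface force `F` on `S₂`. -/
theorem work_eq_of_momentum (hΩ : IsOpen Ω) (hb : Bornology.IsBounded Ω)
    (hS : IsBoundarySplitting A S₁ S₂) {K F : Vec n → Vec n}
    (hK : MemLp K 2 (volume.restrict Ω)) (hF : MemLp F 2 (A.surfaceMeasure.restrict S₂))
    {p q : Vec n → ℝ} {σ T : Fin n → Fin n → Vec n → ℝ} (hp : MemH1 Ω p)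
    (hσ : ∀ i j, MemH1 Ω (σ i j)) (hsymm : ∀ i j x, σ i j x = σ j i x)
    (hmom : ∀ i, ∀ᵐ x ∂(volume.restrict Ω),
      weakPartial Ω p i x - 2 * ∑ j, weakPartial Ω (σ i j) j x = K x i)
    (hq : IsTrace A p q) (hT : ∀ i j, IsTrace A (σ i j) (T i j))
    (hbd : ∀ i, ∀ᵐ x ∂(A.surfaceMeasure.restrict S₂),
      ∑ j, (-(q x) * (if i = j then 1 else 0) + 2 * T i j x) * A.normal x j = F x i)
    {w : Vec n → Vec n} (hw : w ∈ V A S₁) :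
    volumeWork Ω K w + surfaceWork A S₂ F w =
      2 * ∫ x in Ω, ∑ i, ∑ j, σ i j x * strain Ω w i j x := by
  have hwH := hw.1.1
  set g : Fin n → Vec n → ℝ := fun i => trace A fun x => w x i with hgdef
  have hg : ∀ i, IsTrace A (fun x => w x i) (g i) := isTrace_trace_of_mem_V hw
  have hKi : ∀ i, MemLp (fun x => K x i) 2 (volume.restrict Ω) := fun i =>
    (EuclideanSpace.proj (𝕜 := ℝ) i).comp_memLp' hK
  have hFi : ∀ i, MemLp (fun x => F x i) 2 (A.surfaceMeasure.restrict S₂) := fun i =>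
    (EuclideanSpace.proj (𝕜 := ℝ) i).comp_memLp' hF
  set D : Fin n → Fin n → Vec n → ℝ := fun i j => weakPartial Ω (fun x => w x i) j with hD
  have hDL : ∀ i j, MemLp (D i j) 2 (volume.restrict Ω) := fun i j =>
    (hwH i).memLp_weakPartial j
  -- Green's formula for the volume force, componentwise
  have hvol : ∀ i, ∫ x in Ω, K x i * w x i =
      (∫ x, q x * A.normal x i * g i x ∂A.surfaceMeasure) - (∫ x in Ω, p x * D i i x) -
        2 * ∑ j, ((∫ x, T i j x * A.normal x j * g i x ∂A.surfaceMeasure) -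
          ∫ x in Ω, σ i j x * D i j x) := by
    intro i
    have h1 : ∫ x in Ω, K x i * w x i =
        ∫ x in Ω, (weakPartial Ω p i x * w x i -
          2 * ∑ j, weakPartial Ω (σ i j) j x * w x i) := by
      refine integral_congr_ae ?_
      filter_upwards [hmom i] with x hx
      rw [← hx, sub_mul, mul_assoc, Finset.sum_mul]
    have hi1 := integrable_mul_of_memLp_two (hp.memLp_weakPartial i) (hwH i).1
    have hi2 := fun j => integrable_mul_of_memLp_two ((hσ i j).memLp_weakPartial j) (hwH i).1
    rw [h1, integral_sub hi1 ((integrable_finsetSum _ fun j _ => hi2 j).const_mul 2),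
      integral_const_mul, integral_finsetSum _ fun j _ => hi2 j]
    have hG1 := green hΩ hb hp hq (hwH i) (hg i) i
    have hG2 := fun j => green hΩ hb (hσ i j) (hT i j) (hwH i) (hg i) j
    rw [← hG1]
    simp only [← hG2]
    simp [hD]
  -- the boundary terms
  have hqi : ∀ i, Integrable (fun x => q x * A.normal x i * g i x) A.surfaceMeasure := fun i =>
    integrable_mul_of_memLp_two (memLp_mul_normal A hΩ hq.1 i) (hg i).1
  have hTi : ∀ i j, Integrable (fun x => T i j x * A.normal x j * g i x) A.surfaceMeasure :=
    fun i j => integrable_mul_of_memLp_two (memLp_mul_normal A hΩ (hT i j).1 j) (hg i).1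
  have hsurf : ∀ i, ∫ x in S₂, F x i * g i x ∂A.surfaceMeasure =
      -(∫ x, q x * A.normal x i * g i x ∂A.surfaceMeasure) +
        2 * ∑ j, ∫ x, T i j x * A.normal x j * g i x ∂A.surfaceMeasure := by
    intro i
    have hneg : Integrable (fun x => -(q x * A.normal x i * g i x)) A.surfaceMeasure :=
      (hqi i).neg
    rw [← integral_finsetSum _ fun j _ => hTi i j, ← integral_const_mul, ← integral_neg,
      ← integral_add hneg ((integrable_finsetSum _ fun j _ => hTi i j).const_mul 2),
      ← integral_indicator hS.measurableSet_snd]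
    refine integral_congr_ae ?_
    have hbi := hbd i
    rw [ae_restrict_iff' hS.measurableSet_snd] at hbi
    filter_upwards [hS.ae_mem hΩ, hbi, trace_ae_eq_zero_of_mem_V hΩ hb hS hw i] with x hx hF2 h0
    -- On `S₂` the traction is `F`; elsewhere on the boundary, up to a null set, the point is in
    -- `S₁` and the trace of `w` vanishes. So the integral over `S₂` extends to the whole boundary.
    by_cases h2 : x ∈ S₂
    · rw [indicator_of_mem h2, ← hF2 h2]
      simp only [add_mul, Finset.sum_add_distrib]
      simp only [mul_ite, mul_one, mul_zero, ite_mul, zero_mul, Finset.sum_ite_eq,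
        Finset.mem_univ, if_true]
      rw [Finset.sum_mul, Finset.mul_sum]
      simp only [mul_assoc, neg_mul]
    · have hz : g i x = 0 := h0 (hx.resolve_right h2)
      rw [indicator_of_notMem h2]
      simp [hz]
  -- the pressure term vanishes
  have hpress : ∑ i, ∫ x in Ω, p x * D i i x = 0 := by
    rw [← integral_finsetSum _ fun i _ => integrable_mul_of_memLp_two hp.1 (hDL i i)]
    refine integral_eq_zero_of_ae ?_
    filter_upwards [hw.2] with x hx
    rw [← Finset.mul_sum, hx]
    simp
  -- the viscous term
  have hσD := fun i j => integrable_mul_of_memLp_two (hσ i j).1 (hDL i j)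
  have hvisc : ∫ x in Ω, ∑ i, ∑ j, σ i j x * strain Ω w i j x =
      ∑ i, ∑ j, ∫ x in Ω, σ i j x * D i j x := by
    -- A symmetric tensor does not see the antisymmetric part of the gradient.
    have e : ∀ x, ∑ i, ∑ j, σ i j x * strain Ω w i j x = ∑ i, ∑ j, σ i j x * D i j x := by
      intro x
      have hsw : ∑ i, ∑ j, σ i j x * D j i x = ∑ i, ∑ j, σ i j x * D i j x := by
        rw [Finset.sum_comm]
        exact Finset.sum_congr rfl fun i _ => Finset.sum_congr rfl fun j _ => by rw [hsymm]
      have : ∑ i, ∑ j, σ i j x * strain Ω w i j x =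
          ((∑ i, ∑ j, σ i j x * D i j x) + ∑ i, ∑ j, σ i j x * D j i x) / 2 := by
        simp only [← Finset.sum_add_distrib, Finset.sum_div]
        refine Finset.sum_congr rfl fun i _ => Finset.sum_congr rfl fun j _ => ?_
        simp only [strain, hD]
        ring
      rw [this, hsw]
      ring
    simp only [e]
    rw [integral_finsetSum _ fun i _ => integrable_finsetSum _ fun j _ => hσD i j]
    exact Finset.sum_congr rfl fun i _ => integral_finsetSum _ fun j _ => hσD i j
  have hgS : ∀ i, MemLp (g i) 2 (A.surfaceMeasure.restrict S₂) := fun i => (hg i).1.restrict S₂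
  have hV : volumeWork Ω K w = ∑ i, ∫ x in Ω, K x i * w x i :=
    integral_finsetSum _ fun i _ => integrable_mul_of_memLp_two (hKi i) (hwH i).1
  have hSW : surfaceWork A S₂ F w = ∑ i, ∫ x in S₂, F x i * g i x ∂A.surfaceMeasure :=
    integral_finsetSum _ fun i _ => integrable_mul_of_memLp_two (hFi i) (hgS i)
  rw [hV, hSW, hvisc, Finset.sum_congr rfl fun i _ => hvol i,
    Finset.sum_congr rfl fun i _ => hsurf i]
  simp only [Finset.sum_sub_distrib, Finset.sum_add_distrib, Finset.sum_neg_distrib,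
    ← Finset.mul_sum]
  rw [hpress]
  ring

end WeakForm

/-! ### Material functions along a velocity field -/

/-- Cauchy–Schwarz: both vectors have length at most `1`, the first by the triangle inequality and
`|𝟙| = √n`. The convention `0⁻¹ = 0` covers vanishing denominators. -/
theorem angle_mem_Icc {α : ℝ} (hα : 0 ≤ α) (uc : Vec n) (u E : Vec n → Vec n) (x : Vec n) :
    angle α uc u E x ∈ Icc (0 : ℝ) 1 := by
  refine ⟨sq_nonneg _, ?_⟩
  rw [angle, sq_le_one_iff_abs_le_one, ← Real.norm_eq_abs]
  refine (norm_inner_le_norm _ _).trans (mul_le_one₀ ?_ (norm_nonneg _) ?_)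
  · have hpos : 0 ≤ α * Real.sqrt n + ‖u x + uc‖ := by positivity
    rw [norm_smul, norm_inv, Real.norm_of_nonneg hpos]
    refine inv_mul_le_one_of_le₀ ?_ hpos
    rw [add_assoc]
    refine (norm_add_le _ _).trans (add_le_add ?_ le_rfl)
    rw [norm_smul, Real.norm_of_nonneg hα, EuclideanSpace.norm_eq]
    simp
  · rw [norm_smul, norm_inv, norm_norm]
    exact inv_mul_le_one

theorem MemH1Vec.aestronglyMeasurable {u : Vec n → Vec n} (hu : MemH1Vec Ω u) :
    AEStronglyMeasurable u (volume.restrict Ω) := by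
  have h : AEMeasurable (fun x i => u x i) (volume.restrict Ω) :=
    aemeasurable_pi_iff.2 fun i => (hu i).1.1.aemeasurable
  exact ((PiLp.continuous_toLp 2 (fun _ : Fin n => ℝ)).measurable.comp_aemeasurable
    h).aestronglyMeasurable

theorem aestronglyMeasurable_angle (α : ℝ) (uc : Vec n) {u E : Vec n → Vec n}
    {m : Measure (Vec n)} (hu : AEStronglyMeasurable u m) (hE : AEStronglyMeasurable E m) :
    AEStronglyMeasurable (angle α uc u E) m := by
  have h1 : AEMeasurable (fun x => (α * Real.sqrt n + ‖u x + uc‖)⁻¹) m :=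
    (((hu.add_const uc).norm.aemeasurable).const_add _).inv
  have h2 : AEMeasurable (fun x => ‖E x‖⁻¹) m := hE.norm.aemeasurable.inv
  exact ((h1.aestronglyMeasurable.smul ((hu.const_add _).add_const uc)).inner
    (h2.aestronglyMeasurable.smul hE)).pow 2

theorem PlasticityCoefficient.aestronglyMeasurable_comp {b : ℝ → ℝ → ℝ}
    (hb : PlasticityCoefficient b) {m : Measure (Vec n)} {e θ : Vec n → ℝ}
    (he : AEStronglyMeasurable e m) (hθ : AEStronglyMeasurable θ m) (he0 : ∀ x, 0 ≤ e x)
    (hθ0 : ∀ x, θ x ∈ Icc (0 : ℝ) 1) : AEStronglyMeasurable (fun x => b (e x) (θ x)) m := by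
  -- `b` is continuous only on `ℝ₊ × [0,1]`; composing with the retraction onto this set makes it
  -- continuous everywhere without changing the values that occur.
  let c : ℝ × ℝ → ℝ × ℝ := fun y => (max 0 y.1, max 0 (min 1 y.2))
  have hc : Continuous fun y : ℝ × ℝ => b (c y).1 (c y).2 :=
    hb.1.comp_continuous (f := c) (by fun_prop) fun y =>
      ⟨mem_Ici.2 (le_max_left _ _), le_max_left _ _, max_le zero_le_one (min_le_left _ _)⟩
  refine (hc.comp_aestronglyMeasurable (he.prodMk hθ)).congr (ae_of_all _ fun x => ?_)
  simp [c, he0 x, (hθ0 x).1, (hθ0 x).2]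

theorem ContinuousMaterial.aestronglyMeasurable_comp {ψ : ℝ → ℝ → ℝ → ℝ}
    (hψ : ContinuousMaterial ψ) {m : Measure (Vec n)} {s e θ : Vec n → ℝ}
    (hs : AEStronglyMeasurable s m) (he : AEStronglyMeasurable e m)
    (hθ : AEStronglyMeasurable θ m) (hs0 : ∀ x, 0 ≤ s x) (he0 : ∀ x, 0 ≤ e x)
    (hθ0 : ∀ x, θ x ∈ Icc (0 : ℝ) 1) : AEStronglyMeasurable (fun x => ψ (s x) (e x) (θ x)) m := by
  let c : ℝ × ℝ × ℝ → ℝ × ℝ × ℝ := fun y => (max 0 y.1, max 0 y.2.1, max 0 (min 1 y.2.2))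
  have hc : Continuous fun y : ℝ × ℝ × ℝ => ψ (c y).1 (c y).2.1 (c y).2.2 :=
    ContinuousOn.comp_continuous hψ (f := c) (by fun_prop) fun y =>
      ⟨mem_Ici.2 (le_max_left _ _), mem_Ici.2 (le_max_left _ _), le_max_left _ _,
        max_le zero_le_one (min_le_left _ _)⟩
  refine (hc.comp_aestronglyMeasurable (hs.prodMk (he.prodMk hθ))).congr
    (ae_of_all _ fun x => ?_)
  simp [c, hs0 x, he0 x, (hθ0 x).1, (hθ0 x).2]

theorem continuous_and_bounded_of_material {ψ : ℝ → ℝ → ℝ → ℝ}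
    (hψ : DifferentiableMaterial ψ ∨ StronglyMonotoneMaterial ψ ∨ StrictlyMonotoneMaterial ψ) :
    ContinuousMaterial ψ ∧ ∃ C : ℝ, ∀ y₁ ∈ Ici (0 : ℝ), ∀ y₂ ∈ Ici (0 : ℝ),
      ∀ y₃ ∈ Icc (0 : ℝ) 1, ‖ψ y₁ y₂ y₃‖ ≤ C := by
  rcases hψ with ⟨hc, -, a₁, a₂, a₃, a₄, h1, -, -, -, h⟩ | ⟨hc, a₁, a₂, a₃, h1, -, -, h⟩ |
    ⟨hc, a₁, a₂, h1, -, h⟩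
  · refine ⟨hc, a₂, fun y₁ hy₁ y₂ hy₂ y₃ hy₃ => ?_⟩
    obtain ⟨hl, hu, -, -⟩ := h y₁ hy₁ y₂ hy₂ y₃ hy₃
    rwa [Real.norm_of_nonneg (h1.le.trans hl)]
  all_goals
    refine ⟨hc, a₂, fun y₁ hy₁ y₂ hy₂ y₃ hy₃ => ?_⟩
    obtain ⟨hl, hu⟩ := (h y₂ hy₂ y₃ hy₃).1 y₁ hy₁
    rwa [Real.norm_of_nonneg (h1.le.trans hl)]

theorem inv2_nonneg (u : Vec n → Vec n) (x : Vec n) : 0 ≤ inv2 Ω u x :=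
  Finset.sum_nonneg fun _ _ => Finset.sum_nonneg fun _ _ => sq_nonneg _

theorem MemH1Vec.integrable_inv2 {u : Vec n → Vec n} (hu : MemH1Vec Ω u) :
    Integrable (inv2 Ω u) (volume.restrict Ω) :=
  integrable_finsetSum _ fun i _ => integrable_finsetSum _ fun j _ =>
    (hu.memLp_strain i j).integrable_sq

theorem MemH1Vec.integrable_sqrt_inv2 (hb : Bornology.IsBounded Ω) {u : Vec n → Vec n}
    (hu : MemH1Vec Ω u) : Integrable (fun x => Real.sqrt (inv2 Ω u x)) (volume.restrict Ω) := by
  have := isFiniteMeasure_restrict_of_isBounded hb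
  have hI := hu.integrable_inv2
  refine ((integrable_const (1 : ℝ)).add hI).mono
    (Real.continuous_sqrt.comp_aestronglyMeasurable hI.1) (ae_of_all _ fun x => ?_)
  have h0 := inv2_nonneg (Ω := Ω) u x
  rw [Real.norm_of_nonneg (Real.sqrt_nonneg _)]
  simp only [Pi.add_apply]
  rw [Real.norm_of_nonneg (by positivity)]
  -- `√t ≤ 1 + t`, and the right side is integrable because `Ω` has finite measure.
  nlinarith [Real.sq_sqrt h0, sq_nonneg (Real.sqrt (inv2 Ω u x) - 1)]

theorem sum_strain_mul_strain_le (u h : Vec n → Vec n) (x : Vec n) :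
    ∑ i, ∑ j, strain Ω u i j x * strain Ω h i j x ≤
      Real.sqrt (inv2 Ω u x) * Real.sqrt (inv2 Ω h x) := by
  have := Real.sum_mul_le_sqrt_mul_sqrt (Finset.univ : Finset (Fin n × Fin n))
    (fun z => strain Ω u z.1 z.2 x) (fun z => strain Ω h z.1 z.2 x)
  simpa only [Fintype.sum_prod_type, inv2] using this

/-- The subgradient inequality for the norm, with `s = |ε(u)|`, `t = |ε(ut + h)|` and `r` their
scalar product. At `s = 0` the quotient `β / 0` is `0`, and only `0 ≤ β t` is left. -/
theorem plastic_dissipation_le {β s t r : ℝ} (hβ : 0 ≤ β) (hs : 0 ≤ s) (ht : 0 ≤ t)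
    (hr : r ≤ s * t) : β / s * (r - s ^ 2) ≤ β * t - β * s := by
  rcases hs.eq_or_lt with rfl | hs
  · simp
    positivity
  · have : β / s * (r - s ^ 2) ≤ β / s * (s * t - s ^ 2) := by gcongr
    refine this.trans_eq ?_
    field_simp

end ERFluid

/-! ### The variational inequality -/

open ERFluid in
theorem theorem4p1 {n : ℕ} (hn : n = 2 ∨ n = 3) {Ω : Set (ERFluid.Vec n)}
    (hΩ_open : IsOpen Ω) (hΩ_conn : IsConnected Ω) (hΩ_bdd : Bornology.IsBounded Ω)
    (A : ERFluid.LipschitzBoundary Ω)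
    {S₁ S₂ : Set (ERFluid.Vec n)} (hS : ERFluid.IsBoundarySplitting A S₁ S₂)
    (E : ERFluid.Vec n → ERFluid.Vec n) (hE : AEStronglyMeasurable E (volume.restrict Ω))
    (α : ℝ) (hα : 0 ≤ α) (uc : ERFluid.Vec n)
    (b : ℝ → ℝ → ℝ) (hb : ERFluid.PlasticityCoefficient b)
    (ψ : ℝ → ℝ → ℝ → ℝ)
    (hψ : ERFluid.DifferentiableMaterial ψ ∨ ERFluid.StronglyMonotoneMaterial ψ ∨
      ERFluid.StrictlyMonotoneMaterial ψ)
    (K F ub : ERFluid.Vec n → ERFluid.Vec n)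
    (hK : MemLp K 2 (volume.restrict Ω)) (hF : MemLp F 2 (A.surfaceMeasure.restrict S₂))
    (ut : ERFluid.Vec n → ERFluid.Vec n) (hut : ERFluid.MemH1Vec Ω ut)
    (hut_bdry : ERFluid.EqOnBoundary A S₁ ut ub) (hut_div : ERFluid.DivFree Ω ut)
    (v : ERFluid.Vec n → ERFluid.Vec n) (p : ERFluid.Vec n → ℝ)
    -- `α` is positive; the value `α = 0` is permitted if `u + uc ≠ 0` almost everywhere
    (hα_zero : α = 0 → ∀ᵐ x ∂(volume.restrict Ω), ut x + v x + uc ≠ 0)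
    (hreg : ERFluid.IsRegularSolution A S₁ S₂ α uc E b ψ K F ub (ut + v) p) :
    v ∈ ERFluid.V A S₁ ∧
      ∀ h ∈ ERFluid.V A S₁,
        ERFluid.J Ω α uc E b ut v h - ERFluid.J Ω α uc E b ut v v
            + ERFluid.L Ω α uc E ψ ut v (h - v) ≥
          ERFluid.volumeWork Ω K (h - v) + ERFluid.surfaceWork A S₂ F (h - v) := by
  have hv : MemH1Vec Ω v := by
    have := hreg.velocity_mem.sub hΩ_open hΩ_bdd hut
    rwa [add_sub_cancel_left] at this
  have hvV : v ∈ V A S₁ := by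
    have := sub_mem_V hΩ_open hΩ_bdd hreg.velocity_mem hut hreg.velocity_boundary hut_bdry
      hreg.incompressible hut_div
    rwa [add_sub_cancel_left] at this
  refine ⟨hvV, fun h hh => ?_⟩
  have hhH := hh.1.1
  have hwV : h - v ∈ V A S₁ :=
    sub_mem_V hΩ_open hΩ_bdd hhH hv hh.1.2 hvV.1.2 hh.2 hvV.2
  obtain ⟨q, T, hq, hT, hbd⟩ := hreg.stress_boundary
  have hwork := work_eq_of_momentum hΩ_open hΩ_bdd hS hK hF hreg.pressure_mem hreg.stress_mem
    (fun i j x => by simp only [strain]; ring) hreg.momentum hq hT hbd hwV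
  set u := ut + v with hu
  have huH : MemH1Vec Ω u := hreg.velocity_mem
  have hsH : MemH1Vec Ω (ut + h) := hut.add hΩ_open hΩ_bdd hhH
  have hwH : MemH1Vec Ω (h - v) := hwV.1.1
  obtain ⟨hψc, C, hC⟩ := continuous_and_bounded_of_material hψ
  have hθ : ∀ x, angle α uc u E x ∈ Icc (0 : ℝ) 1 := angle_mem_Icc hα uc u E
  have hθm := aestronglyMeasurable_angle α uc huH.aestronglyMeasurable hE
  have hbm : AEStronglyMeasurable (fun x => b ‖E x‖ (angle α uc u E x)) (volume.restrict Ω) :=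
    hb.aestronglyMeasurable_comp hE.norm hθm (fun _ => norm_nonneg _) hθ
  obtain ⟨a₅, -, ha₅⟩ := hb.2
  have hb0 : ∀ x, 0 ≤ b ‖E x‖ (angle α uc u E x) := fun x => (ha₅ _ (norm_nonneg _) _ (hθ x)).1
  have hbB : ∀ x, ‖b ‖E x‖ (angle α uc u E x)‖ ≤ a₅ := fun x => by
    rw [Real.norm_of_nonneg (hb0 x)]
    exact (ha₅ _ (norm_nonneg _) _ (hθ x)).2
  have hψm : AEStronglyMeasurable (fun x => ψ (inv2 Ω u x) ‖E x‖ (angle α uc u E x))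
      (volume.restrict Ω) :=
    hψc.aestronglyMeasurable_comp huH.integrable_inv2.1 hE.norm hθm (inv2_nonneg u)
      (fun _ => norm_nonneg _) hθ
  have iJh : Integrable (fun x => b ‖E x‖ (angle α uc u E x) * Real.sqrt (inv2 Ω (ut + h) x))
      (volume.restrict Ω) :=
    (hsH.integrable_sqrt_inv2 hΩ_bdd).bdd_mul hbm (ae_of_all _ hbB)
  have iJv : Integrable (fun x => b ‖E x‖ (angle α uc u E x) * Real.sqrt (inv2 Ω u x))
      (volume.restrict Ω) :=
    (huH.integrable_sqrt_inv2 hΩ_bdd).bdd_mul hbm (ae_of_all _ hbB)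
  have iL : Integrable (fun x => ψ (inv2 Ω u x) ‖E x‖ (angle α uc u E x) *
      ∑ i, ∑ j, strain Ω u i j x * strain Ω (h - v) i j x) (volume.restrict Ω) :=
    (integrable_finsetSum _ fun i _ => integrable_finsetSum _ fun j _ =>
      integrable_mul_of_memLp_two (huH.memLp_strain i j) (hwH.memLp_strain i j)).bdd_mul hψm
      (ae_of_all _ fun x => hC _ (inv2_nonneg u x) _ (norm_nonneg _) _ (hθ x))
  -- No bound on the viscosity itself is available; the product `φ ε(u)` is square integrable by the
  -- definition of a regular solution.
  have iσ : Integrable (fun x => ∑ i, ∑ j, viscosity Ω α uc E b ψ u x * strain Ω u i j x *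
      strain Ω (h - v) i j x) (volume.restrict Ω) :=
    integrable_finsetSum _ fun i _ => integrable_finsetSum _ fun j _ =>
      integrable_mul_of_memLp_two (hreg.stress_mem i j).1 (hwH.memLp_strain i j)
  have iJ : Integrable (fun x => b ‖E x‖ (angle α uc u E x) * Real.sqrt (inv2 Ω (ut + h) x) -
      b ‖E x‖ (angle α uc u E x) * Real.sqrt (inv2 Ω u x)) (volume.restrict Ω) := iJh.sub iJv
  have key : ∫ x in Ω, ∑ i, ∑ j, viscosity Ω α uc E b ψ u x * strain Ω u i j x *
        strain Ω (h - v) i j x ≤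
      ∫ x in Ω, (b ‖E x‖ (angle α uc u E x) * Real.sqrt (inv2 Ω (ut + h) x) -
        b ‖E x‖ (angle α uc u E x) * Real.sqrt (inv2 Ω u x) +
        ψ (inv2 Ω u x) ‖E x‖ (angle α uc u E x) *
          ∑ i, ∑ j, strain Ω u i j x * strain Ω (h - v) i j x) := by
    refine integral_mono_ae iσ (iJ.add iL) ?_
    -- The lift `ut` cancels, so the strain of the test function is a difference of the two strains
    -- whose norms enter `J`.
    have hdiff : (ut + h) - u = h - v := by rw [hu]; abel
    have hst := strain_sub hΩ_open hΩ_bdd hsH huH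
    rw [hdiff] at hst
    filter_upwards [hst] with x hx
    have e1 : ∑ i, ∑ j, viscosity Ω α uc E b ψ u x * strain Ω u i j x *
        strain Ω (h - v) i j x = viscosity Ω α uc E b ψ u x *
          ∑ i, ∑ j, strain Ω u i j x * strain Ω (h - v) i j x := by
      simp only [Finset.mul_sum, mul_assoc]
    have e2 : ∑ i, ∑ j, strain Ω u i j x * strain Ω (h - v) i j x =
        (∑ i, ∑ j, strain Ω u i j x * strain Ω (ut + h) i j x) -
          Real.sqrt (inv2 Ω u x) ^ 2 := by
      rw [Real.sq_sqrt (inv2_nonneg u x), inv2, ← Finset.sum_sub_distrib]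
      refine Finset.sum_congr rfl fun i _ => ?_
      rw [← Finset.sum_sub_distrib]
      refine Finset.sum_congr rfl fun j _ => ?_
      rw [hx i j]
      ring
    have hle := plastic_dissipation_le (hb0 x) (Real.sqrt_nonneg (inv2 Ω u x))
      (Real.sqrt_nonneg (inv2 Ω (ut + h) x)) (sum_strain_mul_strain_le u (ut + h) x)
    rw [← e2] at hle
    rw [e1, viscosity, add_mul]
    linarith
  rw [integral_add iJ iL, integral_sub iJh iJv] at key
  rw [hwork, ge_iff_le]
  simp only [J, L, ← hu]
  linarith
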